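/- Let $(M,h)$ be a smooth Lorentzian manifold of dimension $n+2$ with Levi-Civita connection $\nabla$ and curvature $\mathcal R(U,V)=\nabla_U\nabla_V-\nabla_V\nabla_U-\nabla_{[U,V]}$. Let $X$ be a recurrent light-like vector field on $M$, i.e. a smooth nowhere vanishing vector field with $h(X,X)=0$ and $\nabla X=\Theta\otimes X$ for a one-form $\Theta$. Let $\Xi=\mathbb R X\subset\Xi^\perp=\{U\in TM\mid h(U,X)=0\}$ be the parallel distributions defined by $X$, and let $\mathcal S=\Xi^\perp/\Xi$ be the screen bundle with the connection $\nabla^{\mathcal S}_U[V]=[\nabla_UV]$. Assume that $(M,h)$ has light-like hypersurface curvature, i.e. $\mathcal R(U,V)$ maps $\Xi^\perp$ to $\Xi$ for all $U,V\in\Xi^\perp$. Suppose that around every point of $M$ there are local coordinates $(x,y_1,\dots,y_n,z)$ in which $$h=2\,dx\,dz+f\,dz^2+\Big(\sum_{i=1}^n u_i\,dy_i\Big)dz+\sum_{i=1}^n dy_i^2$$ with smooth functions $f,u_1,\dots,u_n$ such that $\frac{\partial u_i}{\partial x}=0$ for all $i$, and such that the $z$-dependent family of one-forms $\phi_z=\sum_{k=1}^n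 u_k\,dy_k$ in the variables $y$ is closed for every $z$, i.e. $\frac{\partial u_l}{\partial y_k}=\frac{\partial u_k}{\partial y_l}$ for all $k,l$. Then $(M,h)$ is a pr-wave, i.e. $\mathcal R(U,V)$ maps $\Xi^\perp$ to $\Xi$ for all $U,V\in TM$, and it has trivial screen holonomy: at every point $p\in M$ the restricted holonomy group of $(\mathcal S,\nabla^{\mathcal S})$, consisting of the parallel displacements along null-homotopic piecewise $C^1$ loops at $p$, is trivial (equivalently, the holonomy algebra of $\nabla^{\mathcal S}$ vanishes, i.e. $\mathcal S$ is flat). -/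

import Mathlib

open scoped Manifold ContDiff Topology

noncomputable section

namespace LorentzScreen

variable {n : ℕ} {M : Type*} [TopologicalSpace M]
  [ChartedSpace (EuclideanSpace ℝ (Fin (n + 2))) M] [IsManifold (𝓡 (n + 2)) ∞ M]

variable (n M) in
/-- Vector fields on `M`; no regularity is built in. -/
abbrev VField : Type _ := (p : M) → TangentSpace (𝓡 (n + 2)) p

/-- The vector field `V` is smooth on the set `O`. -/
def SmoothOn (V : VField n M) (O : Set M) : Prop :=
  ContMDiffOn (𝓡 (n + 2)) (𝓡 (n + 2)).tangent ∞
    (fun p => (⟨p, V p⟩ : TangentBundle (𝓡 (n + 2)) M)) O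

/-- The vector field `V` is smooth at the point `p`. -/
def SmoothAt (V : VField n M) (p : M) : Prop :=
  ContMDiffAt (𝓡 (n + 2)) (𝓡 (n + 2)).tangent ∞
    (fun q => (⟨q, V q⟩ : TangentBundle (𝓡 (n + 2)) M)) p

variable (n M) in
/-- A smooth Lorentzian metric, of signature `(-, +, …, +)`, on a manifold of dimension `n + 2`. -/
structure LorentzMetric where
  /-- the bilinear form on each tangent space -/
  form : (p : M) →
    TangentSpace (𝓡 (n + 2)) p →L[ℝ] TangentSpace (𝓡 (n + 2)) p →L[ℝ] ℝ
  symm : ∀ (p : M) (v w : TangentSpace (𝓡 (n + 2)) p), form p v w = form p w v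
  lorentzian : ∀ p : M, ∃ b : Module.Basis (Fin (n + 2)) ℝ (TangentSpace (𝓡 (n + 2)) p),
    ∀ i j, form p (b i) (b j) = if i = j then (if i = 0 then -1 else 1) else 0
  smooth : ContMDiff (𝓡 (n + 2))
    ((𝓡 (n + 2)).prod 𝓘(ℝ, EuclideanSpace ℝ (Fin (n + 2)) →L[ℝ]
      EuclideanSpace ℝ (Fin (n + 2)) →L[ℝ] ℝ)) ∞
    (fun p => Bundle.TotalSpace.mk' (EuclideanSpace ℝ (Fin (n + 2)) →L[ℝ]
      EuclideanSpace ℝ (Fin (n + 2)) →L[ℝ] ℝ) p (form p))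

/-! ### The Levi-Civita connection and its curvature -/

/-- The derivative `U(φ)` of the function `φ` in the direction of `U`, at `p`. -/
def dirDeriv (U : VField n M) (φ : M → ℝ) (p : M) : ℝ :=
  mvfderiv (𝓡 (n + 2)) φ p (U p)

/-- The right-hand side of Koszul's formula for `2 h(∇_U V, T)`. -/
def koszul (h : LorentzMetric n M) (U V T : VField n M) (p : M) : ℝ :=
  dirDeriv U (fun q => h.form q (V q) (T q)) p
    + dirDeriv V (fun q => h.form q (U q) (T q)) p
    - dirDeriv T (fun q => h.form q (U q) (V q)) p
    + h.form p (VectorField.mlieBracket (𝓡 (n + 2)) U V p) (T p)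
    - h.form p (VectorField.mlieBracket (𝓡 (n + 2)) U T p) (V p)
    - h.form p (VectorField.mlieBracket (𝓡 (n + 2)) V T p) (U p)

/-- `w` is the vector `∇_v V` at `p` according to Koszul's formula. -/
def IsCovDeriv (h : LorentzMetric n M) (V : VField n M) (p : M)
    (v w : TangentSpace (𝓡 (n + 2)) p) : Prop :=
  ∀ U T : VField n M, SmoothAt U p → SmoothAt T p → U p = v →
    2 * h.form p w (T p) = koszul h U V T p

open Classical in
/-- The Levi-Civita derivative `∇_v V` at `p`, for a field `V` that is smooth at `p`
(the value is `0` where Koszul's formula determines no vector, which cannot happen for such `V`). -/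
def covDeriv (h : LorentzMetric n M) (V : VField n M) (p : M)
    (v : TangentSpace (𝓡 (n + 2)) p) : TangentSpace (𝓡 (n + 2)) p :=
  if H : ∃ w, IsCovDeriv h V p v w then H.choose else 0

/-- The vector field `∇_U V`. -/
def nabla (h : LorentzMetric n M) (U V : VField n M) : VField n M :=
  fun p => covDeriv h V p (U p)

/-- The curvature `R(U, V)W = ∇_U ∇_V W - ∇_V ∇_U W - ∇_{[U, V]} W`. -/
def curvature (h : LorentzMetric n M) (U V W : VField n M) : VField n M :=
  fun p => nabla h U (nabla h V W) p - nabla h V (nabla h U W) p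
    - nabla h (VectorField.mlieBracket (𝓡 (n + 2)) U V) W p

/-! ### Recurrent light-like vector fields and the two curvature conditions -/

/-- `X` is a smooth light-like (in particular nowhere vanishing) vector field that is recurrent:
`∇ X = Θ ⊗ X` for a one-form `Θ`. -/
structure IsRecurrentLightlike (h : LorentzMetric n M) (X : VField n M) : Prop where
  smooth : SmoothOn X Set.univ
  ne_zero : ∀ p, X p ≠ 0
  null : ∀ p, h.form p (X p) (X p) = 0
  recurrent : ∃ Θ : (p : M) → TangentSpace (𝓡 (n + 2)) p →L[ℝ] ℝ,
    ∀ (p : M) (v : TangentSpace (𝓡 (n + 2)) p), covDeriv h X p v = Θ p v • X p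

/-- The line `Ξ_p` spanned by `X p`. -/
def line (X : VField n M) (p : M) : Submodule ℝ (TangentSpace (𝓡 (n + 2)) p) :=
  Submodule.span ℝ {X p}

/-- The orthogonal complement of `Ξ_p` in `T_p M`. -/
def perp (h : LorentzMetric n M) (X : VField n M) (p : M) :
    Submodule ℝ (TangentSpace (𝓡 (n + 2)) p) :=
  (h.form p (X p)).toLinearMap.ker

/-- Light-like hypersurface curvature: `R(U, V)` maps `Ξ^⊥` to `Ξ` for all `U, V ∈ Ξ^⊥`. -/
def HasLightlikeHypersurfaceCurvature (h : LorentzMetric n M) (X : VField n M) : Prop :=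
  ∀ (O : Set M), IsOpen O → ∀ U V W : VField n M,
    SmoothOn U O → SmoothOn V O → SmoothOn W O →
    (∀ p ∈ O, U p ∈ perp h X p) → (∀ p ∈ O, V p ∈ perp h X p) →
    (∀ p ∈ O, W p ∈ perp h X p) →
    ∀ p ∈ O, curvature h U V W p ∈ line X p

/-- `(M, h)` is a pr-wave with recurrent light-like vector field `X`:
`R(U, V)` maps `Ξ^⊥` to `Ξ` for all `U, V ∈ TM`. -/
structure IsPrWave (h : LorentzMetric n M) (X : VField n M) : Prop where
  recurrentLightlike : IsRecurrentLightlike h X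
  curvature_mem : ∀ (O : Set M), IsOpen O → ∀ U V W : VField n M,
    SmoothOn U O → SmoothOn V O → SmoothOn W O →
    (∀ p ∈ O, W p ∈ perp h X p) →
    ∀ p ∈ O, curvature h U V W p ∈ line X p

/-! ### The screen bundle and its holonomy -/

/-- The fibre `Ξ_p^⊥ / Ξ_p` of the screen bundle. -/
abbrev Screen (h : LorentzMetric n M) (X : VField n M) (p : M) : Type _ :=
  perp h X p ⧸ (line X p).submoduleOf (perp h X p)

/-- `W` is a vector field along the curve `t ↦ (W t).proj`. Its covariant derivative at time `t`
exists and equals `w`: near `t`, one can write `W = ∑ⱼ aⱼ Eⱼ` with fields `Eⱼ` on `M` and functions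
`aⱼ` of the time, and `w = ∑ⱼ (aⱼ' Eⱼ + aⱼ ∇_{γ'} Eⱼ)`, where `γ` is the curve. -/
def HasCovDerivAlong (h : LorentzMetric n M) (W : ℝ → TangentBundle (𝓡 (n + 2)) M) (t : ℝ)
    (w : TangentSpace (𝓡 (n + 2)) (W t).proj) : Prop :=
  ∃ (m : ℕ) (a : Fin m → ℝ → ℝ) (E : Fin m → VField n M),
    (∀ j, DifferentiableAt ℝ (a j) t) ∧
    (∀ j, SmoothAt (E j) (W t).proj) ∧
    (∀ᶠ s in 𝓝 t, (W s).2 = ∑ j, a j s • E j (W s).proj) ∧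
    w = ∑ j, (deriv (a j) t • E j (W t).proj + a j t • covDeriv h (E j) (W t).proj
      (mfderiv 𝓘(ℝ, ℝ) (𝓡 (n + 2)) (fun s => (W s).proj) t (1 : ℝ)))

/-- `W` is a continuous field of vectors of `Ξ^⊥` along the path `γ`, and its class `[W]` is a
parallel section of the screen bundle along `γ`, for the connection `∇^S [V] = [∇ V]`: away from
finitely many times the covariant derivative of `W` lies in `Ξ`. -/
def IsScreenParallelAlong (h : LorentzMetric n M) (X : VField n M) {p q : M} (γ : Path p q)
    (W : ℝ → TangentBundle (𝓡 (n + 2)) M) : Prop :=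
  (∀ t ∈ Set.Icc (0 : ℝ) 1, (W t).proj = γ.extend t) ∧
  ContinuousOn W (Set.Icc 0 1) ∧
  (∀ t ∈ Set.Icc (0 : ℝ) 1, (W t).2 ∈ perp h X (W t).proj) ∧
  ∃ F : Set ℝ, F.Finite ∧ ∀ t ∈ Set.Ioo (0 : ℝ) 1 \ F,
    ∃ w ∈ line X (W t).proj, HasCovDerivAlong h W t w

/-- The path `γ` is piecewise continuously differentiable. -/
def IsPiecewiseC1 {p q : M} (γ : Path p q) : Prop :=
  ∃ (m : ℕ) (τ : ℕ → ℝ), Monotone τ ∧ τ 0 = 0 ∧ τ m = 1 ∧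
    ∀ i < m, ContMDiffOn 𝓘(ℝ, ℝ) (𝓡 (n + 2)) 1 γ.extend (Set.Icc (τ i) (τ (i + 1)))

/-- The restricted holonomy group at `p` of the screen bundle: the parallel displacements of the
fibre at `p` along the null-homotopic piecewise continuously differentiable loops at `p`.
Its Lie algebra is the screen holonomy algebra. -/
def restrictedScreenHolonomy (h : LorentzMetric n M) (X : VField n M) (p : M) :
    Set (Screen h X p →ₗ[ℝ] Screen h X p) :=
  {P | ∃ γ : Path p p, IsPiecewiseC1 (n := n) γ ∧ γ.Homotopic (Path.refl p) ∧
    ∀ v : perp h X p, ∃ (v' : perp h X p) (W : ℝ → TangentBundle (𝓡 (n + 2)) M),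
      IsScreenParallelAlong h X γ W ∧ W 0 = ⟨p, v⟩ ∧ W 1 = ⟨p, v'⟩ ∧
      P (Submodule.Quotient.mk v) = Submodule.Quotient.mk v'}

/-- Trivial screen holonomy. -/
def HasTrivialScreenHolonomy (h : LorentzMetric n M) (X : VField n M) : Prop :=
  ∀ p : M, restrictedScreenHolonomy h X p = {LinearMap.id}

/-! ### Adapted coordinates -/

variable (n) in
/-- The space of the coordinates `(x, y, z)`, with `y = (y₁, …, yₙ)`. -/
abbrev Coord : Type := ℝ × EuclideanSpace ℝ (Fin n) × ℝ

/-- `∂/∂x` -/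
def dx : Coord n := (1, 0, 0)

/-- `∂/∂yᵢ` -/
def dy (i : Fin n) : Coord n := (0, EuclideanSpace.single i 1, 0)

/-- The bilinear form with square `2 dx dz + f dz² + (∑ᵢ uᵢ dyᵢ) dz + ∑ᵢ dyᵢ²`. -/
def rrForm (f : ℝ) (u : Fin n → ℝ) (v w : Coord n) : ℝ :=
  (v.1 * w.2.2 + v.2.2 * w.1) + f * (v.2.2 * w.2.2)
    + (1 / 2) * ∑ i, u i * (v.2.1 i * w.2.2 + v.2.2 * w.2.1 i)
    + ∑ i, v.2.1 i * w.2.1 i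

/-- `φ = (x, y, z)` is a smooth coordinate system on an open subset of `M`, in which
`h = 2 dx dz + f dz² + (∑ᵢ uᵢ dyᵢ) dz + ∑ᵢ dyᵢ²` with `∂uᵢ/∂x = 0`. -/
structure IsRRCoordinates (h : LorentzMetric n M) (φ : OpenPartialHomeomorph M (Coord n))
    (f : Coord n → ℝ) (u : Fin n → Coord n → ℝ) : Prop where
  smooth : ContMDiffOn (𝓡 (n + 2)) 𝓘(ℝ, Coord n) ∞ φ φ.source
  smooth_symm : ContMDiffOn 𝓘(ℝ, Coord n) (𝓡 (n + 2)) ∞ φ.symm φ.target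
  smooth_f : ContDiffOn ℝ ∞ f φ.target
  smooth_u : ∀ i, ContDiffOn ℝ ∞ (u i) φ.target
  dx_u : ∀ i, ∀ c ∈ φ.target, fderiv ℝ (u i) c dx = 0
  metric : ∀ c ∈ φ.target, ∀ v w : Coord n,
    h.form (φ.symm c)
      (mfderiv 𝓘(ℝ, Coord n) (𝓡 (n + 2)) φ.symm c v)
      (mfderiv 𝓘(ℝ, Coord n) (𝓡 (n + 2)) φ.symm c w)
    = rrForm (f c) (fun i => u i c) v w

/-- On the open set `O` of coordinate values, the one-forms `∑ₖ uₖ dyₖ` in the variables `y`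
are closed for every fixed `z`. -/
def IsClosedFamily (u : Fin n → Coord n → ℝ) (O : Set (Coord n)) : Prop :=
  ∀ c ∈ O, ∀ k l, fderiv ℝ (u l) c (dy k) = fderiv ℝ (u k) c (dy l)

end LorentzScreen

end

/-! Closedness of the forms `∑ uₖ dyₖ` turns the coordinate fields into parallel screen vectors. Put
K = ∂/∂x and Dⱼ = ∂/∂yⱼ. By Koszul's formula, h(∇Dⱼ, K) only involves ∂uⱼ/∂x, and h(∇Dⱼ, Dₖ) only
the antisymmetric combination ∂ⱼuₖ - ∂ₖuⱼ; both vanish, so ∇K and ∇Dⱼ are multiples of K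
(`IsRRCoordinates.isRecurrentNullFrame`).

The coordinates are not assumed to be adapted to X, so K need not be proportional to X, and κ = h(X,
K) decides. Since X and K are both recurrent, dκ is a one-form times κ; hence κ vanishes near any of
its zeros, and there X is a multiple of K and the Dⱼ themselves serve as a screen frame. Where κ ≠
0, the fields Dⱼ + αⱼ K orthogonal to X have a derivative lying in ℝK ∩ X^⊥ = 0. Either way, near
every point there are orthonormal fields Eⱼ in Ξ^⊥ with ∇Eⱼ in Ξ
(`IsRRCoordinates.exists_parallelScreenFrame`).

For W in Ξ^⊥ this gives h(∇_U W, Eⱼ) = U(h(W, Eⱼ)). So h(R(U, V)W, Eⱼ) is the commutator of U and V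
minus [U, V], applied to a function, which is zero; this is the pr-wave condition
(`IsParallelScreenFrame.curvature_mem`).

For the holonomy, the transition functions between two such frames are locally constant, so the
frames glue the screen fibres with the discrete topology into a covering space of M (`screenCore`).
A parallel screen section along a loop is a lift of that loop, and a lift of a null-homotopic loop
closes up (`IsScreenParallelAlong.sub_mem_line`). -/

noncomputable section

namespace LorentzScreen

variable {n : ℕ} {M : Type*} [TopologicalSpace M]
  [ChartedSpace (EuclideanSpace ℝ (Fin (n + 2))) M] [IsManifold (𝓡 (n + 2)) ∞ M]

set_option linter.unusedSectionVars false

/-! ### Differentiable fields, the metric and directional derivatives -/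

/-- The vector field `V` is differentiable at the point `p`. -/
def DiffAt (V : VField n M) (p : M) : Prop :=
  MDifferentiableAt (𝓡 (n + 2)) (𝓡 (n + 2)).tangent
    (fun q => (⟨q, V q⟩ : TangentBundle (𝓡 (n + 2)) M)) p

/-- The function `φ` is smooth at the point `p`. -/
abbrev SmoothFunAt (φ : M → ℝ) (p : M) : Prop := ContMDiffAt (𝓡 (n + 2)) 𝓘(ℝ, ℝ) ∞ φ p

theorem SmoothAt.diffAt {V : VField n M} {p : M} (hV : SmoothAt V p) : DiffAt V p :=
  ContMDiffAt.mdifferentiableAt hV (by simp)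

theorem SmoothOn.smoothAt {V : VField n M} {O : Set M} (hV : SmoothOn V O) (hO : IsOpen O)
    {p : M} (hp : p ∈ O) : SmoothAt V p :=
  (hV p hp).contMDiffAt (hO.mem_nhds hp)

theorem SmoothAt.eventually_diffAt {V : VField n M} {p : M} (hV : SmoothAt V p) :
    ∀ᶠ q in 𝓝 p, DiffAt V q := by
  have h1 : ContMDiffAt (𝓡 (n + 2)) (𝓡 (n + 2)).tangent 1
    (fun q => (⟨q, V q⟩ : TangentBundle (𝓡 (n + 2)) M)) p := hV.of_le (by simp)
  filter_upwards [(contMDiffAt_iff_contMDiffAt_nhds (by simp)).1 h1] with q hq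
  exact hq.mdifferentiableAt (by simp)

theorem SmoothAt.congr {V V' : VField n M} {p : M} (hV : SmoothAt V p) (h : V' =ᶠ[𝓝 p] V) :
    SmoothAt V' p :=
  ContMDiffAt.congr_of_eventuallyEq hV (h.mono fun q hq => by simp only [hq])

theorem exists_smoothAt {p : M} (v : TangentSpace (𝓡 (n + 2)) p) :
    ∃ V : VField n M, SmoothAt V p ∧ V p = v :=
  ⟨FiberBundle.extend (EuclideanSpace ℝ (Fin (n + 2))) v,
    FiberBundle.contMDiffAt_extend (𝓡 (n + 2)) _ v, by simp⟩

theorem SmoothAt.add {V W : VField n M} {p : M} (hV : SmoothAt V p) (hW : SmoothAt W p) :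
    SmoothAt (V + W) p := ContMDiffAt.add_section hV hW

theorem SmoothAt.smul {f : M → ℝ} {V : VField n M} {p : M} (hV : SmoothAt V p)
    (hf : SmoothFunAt (n := n) f p) : SmoothAt (f • V) p := ContMDiffAt.smul_section hf hV

theorem minSmoothness_real_le_infty (k : ℕ) : minSmoothness ℝ (k : ℕ∞ω) ≤ ∞ := by
  simpa using mod_cast le_top

instance : IsManifold (𝓡 (n + 2)) (minSmoothness ℝ 2) M :=
  IsManifold.of_le (n := ∞) (minSmoothness_real_le_infty 2)

instance : IsManifold (𝓡 (n + 2)) (minSmoothness ℝ 3) M :=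
  IsManifold.of_le (n := ∞) (minSmoothness_real_le_infty 3)

theorem SmoothAt.mlieBracket {V W : VField n M} {p : M} (hV : SmoothAt V p) (hW : SmoothAt W p) :
    SmoothAt (VectorField.mlieBracket (𝓡 (n + 2)) V W) p :=
  have : IsManifold (𝓡 (n + 2)) (((⊤ : ℕ∞) : ℕ∞ω) + 1) M := IsManifold.of_le (n := ∞) (by simp)
  ContMDiffAt.mlieBracket_vectorField (m := ⊤) (n := ⊤) hV hW (by simp)

theorem LorentzMetric.smooth_apply (h : LorentzMetric n M) {V W : VField n M} {p : M}
    (hV : SmoothAt V p) (hW : SmoothAt W p) :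
    SmoothFunAt (n := n) (fun q => h.form q (V q) (W q)) p := by
  have := ContMDiffAt.clm_bundle_apply₂ (F₃ := ℝ) (E₃ := fun _ : M => ℝ) (h.smooth p) hV hW
  exact (Bundle.contMDiffAt_section _).1 this

theorem LorentzMetric.diff_apply (h : LorentzMetric n M) {V W : VField n M} {p : M}
    (hV : DiffAt V p) (hW : DiffAt W p) :
    MDifferentiableAt (𝓡 (n + 2)) 𝓘(ℝ, ℝ) (fun q => h.form q (V q) (W q)) p := by
  have := MDifferentiableAt.clm_bundle_apply₂ (F₃ := ℝ) (E₃ := fun _ : M => ℝ)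
    ((h.smooth p).mdifferentiableAt (by simp)) hV hW
  exact (mdifferentiableAt_section _ _).1 this

theorem LorentzMetric.nondegenerate (h : LorentzMetric n M) {p : M}
    {v : TangentSpace (𝓡 (n + 2)) p} (hv : ∀ w, h.form p v w = 0) : v = 0 := by
  obtain ⟨b, hb⟩ := h.lorentzian p
  have : ∀ i, b.repr v i = 0 := by
    intro i
    have h1 := hv (b i)
    conv_lhs at h1 => rw [← b.sum_repr v]
    simp only [map_sum, map_smul, sum_apply, smul_apply,
      hb, smul_eq_mul] at h1
    by_cases hi : i = 0 <;> simpa [hi] using h1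
  rw [← b.sum_repr v]
  simp [this]

theorem LorentzMetric.exists_form_eq (h : LorentzMetric n M) {p : M}
    (l : TangentSpace (𝓡 (n + 2)) p →ₗ[ℝ] ℝ) : ∃ v, ∀ w, h.form p v w = l w := by
  obtain ⟨b, hb⟩ := h.lorentzian p
  -- The sign compensates `h(b 0, b 0) = -1` in the pseudo-orthonormal basis.
  refine ⟨∑ i, ((if i = 0 then -1 else 1 : ℝ) * l (b i)) • b i, fun w => ?_⟩
  conv_rhs => rw [← b.sum_repr w]
  conv_lhs => rw [← b.sum_repr w]
  simp only [map_sum, map_smul, sum_apply, smul_apply,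
      hb, smul_eq_mul]
  refine Finset.sum_congr rfl fun i _ => ?_
  simp
  grind


theorem DiffAt.add {V W : VField n M} {p : M} (hV : DiffAt V p) (hW : DiffAt W p) :
    DiffAt (V + W) p := mdifferentiableAt_add_section hV hW

theorem DiffAt.smul {f : M → ℝ} {V : VField n M} {p : M}
    (hV : DiffAt V p) (hf : MDifferentiableAt (𝓡 (n + 2)) 𝓘(ℝ, ℝ) f p) : DiffAt (f • V) p := MDifferentiableAt.smul_section hf hV

theorem dirDeriv_add {U : VField n M} {f g : M → ℝ} {p : M}
    (hf : MDifferentiableAt (𝓡 (n + 2)) 𝓘(ℝ, ℝ) f p)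
    (hg : MDifferentiableAt (𝓡 (n + 2)) 𝓘(ℝ, ℝ) g p) :
    dirDeriv U (fun q => f q + g q) p = dirDeriv U f p + dirDeriv U g p := by
  simp only [dirDeriv]
  rw [mvfderiv_fun_add hf hg]; rfl

theorem dirDeriv_mul {U : VField n M} {f g : M → ℝ} {p : M}
    (hf : MDifferentiableAt (𝓡 (n + 2)) 𝓘(ℝ, ℝ) f p)
    (hg : MDifferentiableAt (𝓡 (n + 2)) 𝓘(ℝ, ℝ) g p) :
    dirDeriv U (fun q => f q * g q) p = f p * dirDeriv U g p + g p * dirDeriv U f p := by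
  simp only [dirDeriv]
  rw [mvfderiv_fun_mul hf hg]; rfl

theorem dirDeriv_congr {U : VField n M} {f g : M → ℝ} {p : M} (h : f =ᶠ[𝓝 p] g) :
    dirDeriv U f p = dirDeriv U g p := by
  have := h.mfderiv_eq (I := 𝓡 (n + 2)) (I' := 𝓘(ℝ, ℝ))
  exact congrArg (fun L : TangentSpace (𝓡 (n + 2)) p →L[ℝ] ℝ => L (U p)) this

theorem dirDeriv_const {U : VField n M} (c : ℝ) (p : M) :
    dirDeriv U (fun _ => c) p = 0 := by
  simp only [dirDeriv, mvfderiv_const]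
  rfl

/-! ### Koszul's formula -/

theorem koszul_add_right (h : LorentzMetric n M) {U V T T' : VField n M} {p : M}
    (hU : DiffAt U p) (hV : DiffAt V p) (hT : DiffAt T p) (hT' : DiffAt T' p) :
    koszul h U V (T + T') p = koszul h U V T p + koszul h U V T' p := by
  simp only [koszul, Pi.add_apply, map_add]
  rw [dirDeriv_add (h.diff_apply hV hT) (h.diff_apply hV hT'),
    dirDeriv_add (h.diff_apply hU hT) (h.diff_apply hU hT'),
    VectorField.mlieBracket_add_right hT hT', VectorField.mlieBracket_add_right hT hT']
  simp only [dirDeriv, Pi.add_apply, map_add, add_apply]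
  ring

theorem koszul_smul_right (h : LorentzMetric n M) {U V T : VField n M} {f : M → ℝ} {p : M}
    (hU : DiffAt U p) (hV : DiffAt V p) (hT : DiffAt T p)
    (hf : MDifferentiableAt (𝓡 (n + 2)) 𝓘(ℝ, ℝ) f p) :
    koszul h U V (f • T) p = f p * koszul h U V T p := by
  simp only [koszul, Pi.smul_apply', map_smul, smul_eq_mul]
  rw [dirDeriv_mul hf (h.diff_apply hV hT), dirDeriv_mul hf (h.diff_apply hU hT),
    VectorField.mlieBracket_smul_right hf hT, VectorField.mlieBracket_smul_right hf hT]
  simp only [dirDeriv, Pi.smul_apply', map_smul, smul_eq_mul, map_add, add_apply, smul_apply]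
  rw [h.symm p (T p) (V p), h.symm p (T p) (U p)]
  ring

theorem koszul_add_left (h : LorentzMetric n M) {U U' V T : VField n M} {p : M}
    (hU : DiffAt U p) (hU' : DiffAt U' p) (hV : DiffAt V p) (hT : DiffAt T p) :
    koszul h (U + U') V T p = koszul h U V T p + koszul h U' V T p := by
  simp only [koszul, Pi.add_apply, map_add, add_apply]
  rw [dirDeriv_add (h.diff_apply hU hV) (h.diff_apply hU' hV),
    dirDeriv_add (h.diff_apply hU hT) (h.diff_apply hU' hT),
    VectorField.mlieBracket_add_left hU hU', VectorField.mlieBracket_add_left hU hU']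
  simp only [dirDeriv, Pi.add_apply, map_add, add_apply]
  ring

theorem koszul_smul_left (h : LorentzMetric n M) {U V T : VField n M} {f : M → ℝ} {p : M}
    (hU : DiffAt U p) (hV : DiffAt V p) (hT : DiffAt T p)
    (hf : MDifferentiableAt (𝓡 (n + 2)) 𝓘(ℝ, ℝ) f p) :
    koszul h (f • U) V T p = f p * koszul h U V T p := by
  simp only [koszul, Pi.smul_apply', map_smul, smul_eq_mul, smul_apply]
  rw [dirDeriv_mul hf (h.diff_apply hU hV), dirDeriv_mul hf (h.diff_apply hU hT),
    VectorField.mlieBracket_smul_left hf hU, VectorField.mlieBracket_smul_left hf hU]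
  simp only [dirDeriv, Pi.smul_apply', map_smul, smul_eq_mul, map_add, add_apply, smul_apply]
  ring

theorem koszul_add_mid (h : LorentzMetric n M) {U V V' T : VField n M} {p : M}
    (hU : DiffAt U p) (hV : DiffAt V p) (hV' : DiffAt V' p) (hT : DiffAt T p) :
    koszul h U (V + V') T p = koszul h U V T p + koszul h U V' T p := by
  simp only [koszul, Pi.add_apply, map_add, add_apply]
  rw [dirDeriv_add (h.diff_apply hV hT) (h.diff_apply hV' hT),
    dirDeriv_add (h.diff_apply hU hV) (h.diff_apply hU hV'),
    VectorField.mlieBracket_add_left hV hV', VectorField.mlieBracket_add_right hV hV']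
  simp only [dirDeriv, Pi.add_apply, map_add, add_apply]
  ring

theorem koszul_smul_mid (h : LorentzMetric n M) {U V T : VField n M} {f : M → ℝ} {p : M}
    (hU : DiffAt U p) (hV : DiffAt V p) (hT : DiffAt T p)
    (hf : MDifferentiableAt (𝓡 (n + 2)) 𝓘(ℝ, ℝ) f p) :
    koszul h U (f • V) T p =
      f p * koszul h U V T p + 2 * dirDeriv U f p * h.form p (V p) (T p) := by
  simp only [koszul, Pi.smul_apply', map_smul, smul_eq_mul, smul_apply]
  rw [dirDeriv_mul hf (h.diff_apply hV hT), dirDeriv_mul hf (h.diff_apply hU hV),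
    VectorField.mlieBracket_smul_left hf hV, VectorField.mlieBracket_smul_right hf hV]
  simp only [dirDeriv, Pi.smul_apply', map_smul, smul_eq_mul, map_add, add_apply, smul_apply]
  rw [h.symm p (V p) (U p)]
  ring

theorem tensorialAt_koszul_right (h : LorentzMetric n M) {U V : VField n M} {p : M}
    (hU : DiffAt U p) (hV : DiffAt V p) :
    TensorialAt (𝓡 (n + 2)) (EuclideanSpace ℝ (Fin (n + 2)))
      (fun T : VField n M => koszul h U V T p) p where
  smul hf hT := koszul_smul_right h hU hV hT hf
  add hT hT' := koszul_add_right h hU hV hT hT'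

theorem tensorialAt_koszul_left (h : LorentzMetric n M) {V T : VField n M} {p : M}
    (hV : DiffAt V p) (hT : DiffAt T p) :
    TensorialAt (𝓡 (n + 2)) (EuclideanSpace ℝ (Fin (n + 2)))
      (fun U : VField n M => koszul h U V T p) p where
  smul hf hU := koszul_smul_left h hU hV hT hf
  add hU hU' := koszul_add_left h hU hU' hV hT

theorem isCovDeriv_unique (h : LorentzMetric n M) {V : VField n M} {p : M}
    {v w w' : TangentSpace (𝓡 (n + 2)) p} (hw : IsCovDeriv h V p v w)
    (hw' : IsCovDeriv h V p v w') : w = w' := by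
  refine sub_eq_zero.1 (h.nondegenerate fun t => ?_)
  obtain ⟨U, hU, rfl⟩ := exists_smoothAt v
  obtain ⟨T, hT, rfl⟩ := exists_smoothAt t
  have h1 := hw U T hU hT rfl
  have h2 := hw' U T hU hT rfl
  simp only [map_sub, sub_apply]
  linarith

/-- Koszul's expression is tensorial in `U` and `T`, hence a bilinear form on the tangent space at
`p`, and nondegeneracy of `h` represents it by a vector. -/
theorem exists_covDeriv_form (h : LorentzMetric n M) {V : VField n M} {p : M} (hV : DiffAt V p)
    (v : TangentSpace (𝓡 (n + 2)) p) : ∃ w, ∀ U T : VField n M, DiffAt U p → DiffAt T p →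
      U p = v → 2 * h.form p w (T p) = koszul h U V T p := by
  let B := TensorialAt.mkHom₂ (I := 𝓡 (n + 2)) (F := EuclideanSpace ℝ (Fin (n + 2)))
    (F' := EuclideanSpace ℝ (Fin (n + 2))) (fun U T : VField n M => koszul h U V T p) p
    (fun T hT => tensorialAt_koszul_left h hV hT) (fun U hU => tensorialAt_koszul_right h hU hV)
  obtain ⟨w, hw⟩ := h.exists_form_eq ((1 / 2 : ℝ) • (B v).toLinearMap)
  refine ⟨w, fun U T hU hT hUv => ?_⟩
  subst hUv
  have := TensorialAt.mkHom₂_apply (I := 𝓡 (n + 2)) (F := EuclideanSpace ℝ (Fin (n + 2)))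
    (F' := EuclideanSpace ℝ (Fin (n + 2))) (Φ := fun U T : VField n M => koszul h U V T p) (x := p)
    (fun T hT => tensorialAt_koszul_left h hV hT) (fun U hU => tensorialAt_koszul_right h hU hV)
    hU hT
  rw [hw, ← this]
  simp [B]

/-- Uniqueness identifies the vector chosen in `covDeriv` with the tensorial one. All later
computations with `∇` go through this formula, which only needs differentiability at `p`. -/
theorem two_mul_form_covDeriv (h : LorentzMetric n M) {U V T : VField n M} {p : M}
    (hU : DiffAt U p) (hV : DiffAt V p) (hT : DiffAt T p) :
    2 * h.form p (covDeriv h V p (U p)) (T p) = koszul h U V T p := by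
  obtain ⟨w, hw⟩ := exists_covDeriv_form h hV (U p)
  have hw' : IsCovDeriv h V p (U p) w := fun U' T' hU' hT' => hw U' T' hU'.diffAt hT'.diffAt
  have H : ∃ w, IsCovDeriv h V p (U p) w := ⟨w, hw'⟩
  rw [covDeriv, dif_pos H, isCovDeriv_unique h H.choose_spec hw']
  exact hw U T hU hT rfl

/-! ### Properties of the Levi-Civita derivative -/

theorem LorentzMetric.ext_right (h : LorentzMetric n M) {p : M}
    {v w : TangentSpace (𝓡 (n + 2)) p} (H : ∀ T : VField n M, SmoothAt T p →
      2 * h.form p v (T p) = 2 * h.form p w (T p)) : v = w := by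
  refine sub_eq_zero.1 (h.nondegenerate fun t => ?_)
  obtain ⟨T, hT, rfl⟩ := exists_smoothAt t
  have := H T hT
  simp only [map_sub, sub_apply]
  linarith

theorem covDeriv_zero_right (h : LorentzMetric n M) {V : VField n M} {p : M} (hV : DiffAt V p) :
    covDeriv h V p 0 = 0 := by
  refine h.ext_right fun T hT => ?_
  obtain ⟨U, hU, hU0⟩ := exists_smoothAt (0 : TangentSpace (𝓡 (n + 2)) p)
  have h0 : ((fun _ : M => (0 : ℝ)) • U) p = 0 := by simp
  rw [← h0, two_mul_form_covDeriv h (hU.diffAt.smul mdifferentiableAt_const) hV hT.diffAt,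
    koszul_smul_left h hU.diffAt hV hT.diffAt mdifferentiableAt_const]
  simp

theorem covDeriv_add (h : LorentzMetric n M) {V W : VField n M} {p : M} (hV : DiffAt V p)
    (hW : DiffAt W p) (v : TangentSpace (𝓡 (n + 2)) p) :
    covDeriv h (V + W) p v = covDeriv h V p v + covDeriv h W p v := by
  refine h.ext_right fun T hT => ?_
  obtain ⟨U, hU, rfl⟩ := exists_smoothAt v
  rw [two_mul_form_covDeriv h hU.diffAt (hV.add hW) hT.diffAt,
    koszul_add_mid h hU.diffAt hV hW hT.diffAt, ← two_mul_form_covDeriv h hU.diffAt hV hT.diffAt,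
    ← two_mul_form_covDeriv h hU.diffAt hW hT.diffAt]
  simp only [map_add, add_apply]
  ring

theorem covDeriv_smul (h : LorentzMetric n M) {f : M → ℝ} {V : VField n M} {p : M}
    (hf : MDifferentiableAt (𝓡 (n + 2)) 𝓘(ℝ, ℝ) f p) (hV : DiffAt V p)
    (v : TangentSpace (𝓡 (n + 2)) p) :
    covDeriv h (f • V) p v = mvfderiv (𝓡 (n + 2)) f p v • V p + f p • covDeriv h V p v := by
  refine h.ext_right fun T hT => ?_
  obtain ⟨U, hU, rfl⟩ := exists_smoothAt v
  rw [two_mul_form_covDeriv h hU.diffAt (hV.smul hf) hT.diffAt,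
    koszul_smul_mid h hU.diffAt hV hT.diffAt hf, ← two_mul_form_covDeriv h hU.diffAt hV hT.diffAt]
  simp only [map_add, add_apply, map_smul, smul_apply, smul_eq_mul, dirDeriv]
  ring

/-- The Levi-Civita derivative is metric. -/
theorem mvfderiv_form (h : LorentzMetric n M) {V W : VField n M} {p : M} (hV : DiffAt V p)
    (hW : DiffAt W p) (v : TangentSpace (𝓡 (n + 2)) p) :
    mvfderiv (𝓡 (n + 2)) (fun q => h.form q (V q) (W q)) p v =
      h.form p (covDeriv h V p v) (W p) + h.form p (V p) (covDeriv h W p v) := by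
  obtain ⟨U, hU, rfl⟩ := exists_smoothAt v
  have h1 := two_mul_form_covDeriv h hU.diffAt hV hW
  have h2 := two_mul_form_covDeriv h hU.diffAt hW hV
  rw [h.symm p (V p)]
  simp only [koszul] at h1 h2
  have h3 : (fun q => h.form q (W q) (V q)) = fun q => h.form q (V q) (W q) :=
    funext fun q => h.symm q _ _
  rw [h3] at h2
  rw [VectorField.mlieBracket_swap_apply (V := W)] at h2
  simp only [map_neg, neg_apply] at h2
  simp only [dirDeriv] at h1 h2
  linarith

/-- The Lie bracket of vector fields is the commutator of the directional derivatives. -/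
theorem dirDeriv_mlieBracket {U V : VField n M} {f : M → ℝ} {p : M} (hU : SmoothAt U p)
    (hV : SmoothAt V p) (hf : SmoothFunAt (n := n) f p)
    (hUf : MDifferentiableAt (𝓡 (n + 2)) 𝓘(ℝ, ℝ) (dirDeriv U f) p)
    (hVf : MDifferentiableAt (𝓡 (n + 2)) 𝓘(ℝ, ℝ) (dirDeriv V f) p) :
    dirDeriv (VectorField.mlieBracket (𝓡 (n + 2)) U V) f p =
      dirDeriv U (dirDeriv V f) p - dirDeriv V (dirDeriv U f) p := by
  have hUd := hU.diffAt
  have hVd := hV.diffAt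
  have hfd : MDifferentiableAt (𝓡 (n + 2)) 𝓘(ℝ, ℝ) f p := hf.mdifferentiableAt (by simp)
  obtain ⟨w, hw⟩ := exists_ne (0 : EuclideanSpace ℝ (Fin (n + 2)))
  obtain ⟨W, hW, hWw⟩ := exists_smoothAt (M := M) (p := p) w
  have hWd := hW.diffAt
  have hf1 : ContMDiffAt (𝓡 (n + 2)) 𝓘(ℝ, ℝ) 1 f p := hf.of_le (by simp)
  have hfe : ∀ᶠ q in 𝓝 p, MDifferentiableAt (𝓡 (n + 2)) 𝓘(ℝ, ℝ) f q := by
    filter_upwards [(contMDiffAt_iff_contMDiffAt_nhds (by simp)).1 hf1] with q hq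
    exact hq.mdifferentiableAt (by simp)
  -- A function is read off from brackets through `[V', f W] = (V' f) W + f [V', W]`. Comparing the
  -- Jacobi identities of `U, V, f W` and of `U, V, W` leaves the desired identity as the
  -- coefficient of `W`, which is nonzero at `p`.
  have key : ∀ V' : VField n M, VectorField.mlieBracket (𝓡 (n + 2)) V' (f • W) =ᶠ[𝓝 p]
      (dirDeriv V' f • W + f • VectorField.mlieBracket (𝓡 (n + 2)) V' W : VField n M) := by
    intro V'
    filter_upwards [hfe, hW.eventually_diffAt] with q hq hWq
    exact VectorField.mlieBracket_smul_right hq hWq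
  have hVW := (hV.mlieBracket hW).diffAt
  have hUW := (hU.mlieBracket hW).diffAt
  have J1 := VectorField.leibniz_identity_mlieBracket_apply (I := 𝓡 (n + 2)) (U := U) (V := V)
    (W := f • W) (x := p) (hU.of_le (minSmoothness_real_le_infty 2)) (hV.of_le (minSmoothness_real_le_infty 2)) ((hW.smul hf).of_le (minSmoothness_real_le_infty 2))
  have J2 := VectorField.leibniz_identity_mlieBracket_apply (I := 𝓡 (n + 2)) (U := U) (V := V)
    (W := W) (x := p) (hU.of_le (minSmoothness_real_le_infty 2)) (hV.of_le (minSmoothness_real_le_infty 2)) (hW.of_le (minSmoothness_real_le_infty 2))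
  rw [Filter.EventuallyEq.mlieBracket_vectorField_eq (Filter.EventuallyEq.refl _ U) (key V),
    Filter.EventuallyEq.mlieBracket_vectorField_eq (Filter.EventuallyEq.refl _ V) (key U),
    VectorField.mlieBracket_add_right (hWd.smul hVf) (hVW.smul hfd),
    VectorField.mlieBracket_add_right (hWd.smul hUf) (hUW.smul hfd),
    VectorField.mlieBracket_smul_right hVf hWd, VectorField.mlieBracket_smul_right hfd hVW,
    VectorField.mlieBracket_smul_right hUf hWd, VectorField.mlieBracket_smul_right hfd hUW,
    VectorField.mlieBracket_smul_right hfd hWd, J2] at J1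
  have J3 : (dirDeriv (VectorField.mlieBracket (𝓡 (n + 2)) U V) f p -
      (dirDeriv U (dirDeriv V f) p - dirDeriv V (dirDeriv U f) p)) • W p = 0 := by
    simp only [dirDeriv] at J1 ⊢
    rw [← sub_eq_zero] at J1
    rw [← neg_eq_zero, ← J1]
    module
  have hWp : W p ≠ 0 := by rw [hWw]; exact hw
  exact sub_eq_zero.1 ((smul_eq_zero.1 J3).resolve_right hWp)

/-! ### Coordinate fields -/

/-- The vector field with the components `s` in the coordinates `φ`. -/
def coordField (φ : OpenPartialHomeomorph M (Coord n)) (s : Coord n → Coord n) : VField n M :=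
  VectorField.mpullback (𝓡 (n + 2)) 𝓘(ℝ, Coord n) φ s

section coordinates

variable {h : LorentzMetric n M} {φ : OpenPartialHomeomorph M (Coord n)} {f : Coord n → ℝ}
  {u : Fin n → Coord n → ℝ}

theorem IsRRCoordinates.mdifferentiable (H : IsRRCoordinates h φ f u) :
    φ.MDifferentiable (𝓡 (n + 2)) 𝓘(ℝ, Coord n) :=
  ⟨H.smooth.mdifferentiableOn (by simp), H.smooth_symm.mdifferentiableOn (by simp)⟩

theorem IsRRCoordinates.isInvertible (H : IsRRCoordinates h φ f u) {q : M} (hq : q ∈ φ.source) :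
    (mfderiv (𝓡 (n + 2)) 𝓘(ℝ, Coord n) φ q).IsInvertible :=
  ⟨H.mdifferentiable.mfderiv hq, rfl⟩

theorem IsRRCoordinates.coordField_apply (H : IsRRCoordinates h φ f u) (s : Coord n → Coord n)
    {q : M} (hq : q ∈ φ.source) :
    coordField φ s q = mfderiv 𝓘(ℝ, Coord n) (𝓡 (n + 2)) φ.symm (φ q) (s (φ q)) := by
  have h1 : mfderiv (𝓡 (n + 2)) 𝓘(ℝ, Coord n) φ q = (H.mdifferentiable.mfderiv hq : _ →L[ℝ] _) :=
    rfl
  change (mfderiv (𝓡 (n + 2)) 𝓘(ℝ, Coord n) φ q).inverse (s (φ q)) = _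
  rw [h1, ContinuousLinearMap.inverse_equiv]
  rfl

theorem IsRRCoordinates.exists_linear (H : IsRRCoordinates h φ f u) {q : M}
    (hq : q ∈ φ.source) : ∃ L : Coord n →ₗ[ℝ] TangentSpace (𝓡 (n + 2)) q,
      ∀ s, coordField φ s q = L (s (φ q)) :=
  ⟨(mfderiv 𝓘(ℝ, Coord n) (𝓡 (n + 2)) φ.symm (φ q)).toLinearMap, fun s =>
    H.coordField_apply s hq⟩

theorem IsRRCoordinates.exists_coordField_eq (H : IsRRCoordinates h φ f u)
    {q : M} (hq : q ∈ φ.source) (v : TangentSpace (𝓡 (n + 2)) q) :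
    ∃ e : Coord n, coordField φ (fun _ => e) q = v := by
  refine ⟨mfderiv (𝓡 (n + 2)) 𝓘(ℝ, Coord n) φ q v, ?_⟩
  refine (H.coordField_apply _ hq).trans ?_
  exact (H.mdifferentiable.mfderiv hq).symm_apply_apply v

theorem IsRRCoordinates.mfderiv_coordField (H : IsRRCoordinates h φ f u) (s : Coord n → Coord n)
    {q : M} (hq : q ∈ φ.source) :
    mfderiv (𝓡 (n + 2)) 𝓘(ℝ, Coord n) φ q (coordField φ s q) = s (φ q) := by
  rw [H.coordField_apply _ hq]
  exact (H.mdifferentiable.mfderiv hq).apply_symm_apply _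

theorem IsRRCoordinates.smoothAt (H : IsRRCoordinates h φ f u) {q : M} (hq : q ∈ φ.source) :
    ContMDiffAt (𝓡 (n + 2)) 𝓘(ℝ, Coord n) ∞ φ q :=
  (H.smooth q hq).contMDiffAt (φ.open_source.mem_nhds hq)

theorem IsRRCoordinates.smoothAt_coordField (H : IsRRCoordinates h φ f u) {s : Coord n → Coord n}
    {q : M} (hq : q ∈ φ.source) (hs : ContDiffAt ℝ ∞ s (φ q)) : SmoothAt (coordField φ s) q :=
  ContMDiffAt.mpullback_vectorField_preimage (n := ∞)
    (contMDiffAt_vectorSpace_iff_contDiffAt.2 hs) (H.smoothAt hq) (H.isInvertible hq) (by simp)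

theorem IsRRCoordinates.mlieBracket_coordField (H : IsRRCoordinates h φ f u) (e e' : Coord n)
    {q : M} (hq : q ∈ φ.source) :
    VectorField.mlieBracket (𝓡 (n + 2)) (coordField φ fun _ => e) (coordField φ fun _ => e') q
      = 0 := by
  have hc : ∀ e : Coord n, MDifferentiableAt 𝓘(ℝ, Coord n) 𝓘(ℝ, Coord n).tangent
      (fun c => (⟨c, e⟩ : TangentBundle 𝓘(ℝ, Coord n) (Coord n))) (φ q) := fun e =>
    ContMDiffAt.mdifferentiableAt (n := 1)
      (contMDiffAt_vectorSpace_iff_contDiffAt.2 contDiffAt_const) one_ne_zero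
  have := VectorField.mpullback_mlieBracket (I := 𝓡 (n + 2)) (I' := 𝓘(ℝ, Coord n)) (n := ∞)
    (hc e) (hc e') (H.smoothAt hq) (minSmoothness_real_le_infty 2)
  have h0 : VectorField.mlieBracket 𝓘(ℝ, Coord n)
      (fun x : Coord n => (show TangentSpace 𝓘(ℝ, Coord n) x from e))
      (fun x : Coord n => (show TangentSpace 𝓘(ℝ, Coord n) x from e')) (φ q) = 0 := by
    have h1 : VectorField.lieBracketWithin ℝ (fun _ : Coord n => e) (fun _ => e') Set.univ (φ q)
        = 0 := by simp [VectorField.lieBracketWithin]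
    rw [← VectorField.mlieBracketWithin_univ, VectorField.mlieBracketWithin_eq_lieBracketWithin]
    exact h1
  exact this.symm.trans ((congrArg _ h0).trans (map_zero _))

theorem IsRRCoordinates.form_coordField (H : IsRRCoordinates h φ f u) (s t : Coord n → Coord n)
    {q : M} (hq : q ∈ φ.source) :
    h.form q (coordField φ s q) (coordField φ t q) =
      rrForm (f (φ q)) (fun i => u i (φ q)) (s (φ q)) (t (φ q)) := by
  have := H.metric (φ q) (φ.map_source hq) (s (φ q)) (t (φ q))
  rw [φ.left_inv hq] at this
  rw [H.coordField_apply _ hq, H.coordField_apply _ hq]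
  exact this

theorem IsRRCoordinates.mvfderiv_comp (H : IsRRCoordinates h φ f u) {g : Coord n → ℝ}
    {q : M} (hq : q ∈ φ.source) (hg : DifferentiableAt ℝ g (φ q)) (e : Coord n) :
    mvfderiv (𝓡 (n + 2)) (fun q => g (φ q)) q (coordField φ (fun _ => e) q) =
      fderiv ℝ g (φ q) e := by
  have h1 := mfderiv_comp q (I := 𝓡 (n + 2)) (I' := 𝓘(ℝ, Coord n)) (I'' := 𝓘(ℝ, ℝ)) (g := g)
    hg.mdifferentiableAt ((H.smoothAt hq).mdifferentiableAt (by simp))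
  have h2 := congrArg (fun L : TangentSpace (𝓡 (n + 2)) q →L[ℝ] ℝ =>
    L (coordField φ (fun _ => e) q)) h1
  refine h2.trans ?_
  change mfderiv 𝓘(ℝ, Coord n) 𝓘(ℝ, ℝ) g (φ q) (mfderiv (𝓡 (n + 2)) 𝓘(ℝ, Coord n) φ q
    (coordField φ (fun _ => e) q)) = _
  rw [H.mfderiv_coordField _ hq, mfderiv_eq_fderiv]
  rfl

theorem IsRRCoordinates.differentiableAt_rrForm (H : IsRRCoordinates h φ f u)
    {c : Coord n} (hc : c ∈ φ.target) (e e' : Coord n) :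
    DifferentiableAt ℝ (fun c => rrForm (f c) (fun i => u i c) e e') c := by
  have hf : DifferentiableAt ℝ f c :=
    ((H.smooth_f c hc).contDiffAt (φ.open_target.mem_nhds hc)).differentiableAt (by simp)
  have hu : ∀ i, DifferentiableAt ℝ (u i) c := fun i =>
    ((H.smooth_u i c hc).contDiffAt (φ.open_target.mem_nhds hc)).differentiableAt (by simp)
  unfold rrForm
  fun_prop

theorem IsRRCoordinates.dirDeriv_form (H : IsRRCoordinates h φ f u) (e e₁ e₂ : Coord n)
    {q : M} (hq : q ∈ φ.source) :
    dirDeriv (coordField φ fun _ => e) (fun q => h.form q (coordField φ (fun _ => e₁) q)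
      (coordField φ (fun _ => e₂) q)) q =
    fderiv ℝ (fun c => rrForm (f c) (fun i => u i c) e₁ e₂) (φ q) e := by
  rw [← H.mvfderiv_comp hq (H.differentiableAt_rrForm (φ.map_source hq) e₁ e₂)]
  refine dirDeriv_congr ?_
  filter_upwards [φ.open_source.mem_nhds hq] with q' hq'
  exact H.form_coordField _ _ hq'

theorem IsRRCoordinates.koszul_coordField (H : IsRRCoordinates h φ f u) (e₁ e₂ e₃ : Coord n)
    {q : M} (hq : q ∈ φ.source) :
    2 * h.form q (covDeriv h (coordField φ fun _ => e₂) q (coordField φ (fun _ => e₁) q))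
        (coordField φ (fun _ => e₃) q) =
      fderiv ℝ (fun c => rrForm (f c) (fun i => u i c) e₂ e₃) (φ q) e₁ +
      fderiv ℝ (fun c => rrForm (f c) (fun i => u i c) e₁ e₃) (φ q) e₂ -
      fderiv ℝ (fun c => rrForm (f c) (fun i => u i c) e₁ e₂) (φ q) e₃ := by
  have hs : ∀ e : Coord n, DiffAt (coordField φ fun _ => e) q := fun e =>
    (H.smoothAt_coordField hq contDiffAt_const).diffAt
  rw [two_mul_form_covDeriv h (hs e₁) (hs e₂) (hs e₃)]
  simp only [koszul, H.mlieBracket_coordField _ _ hq, H.dirDeriv_form _ _ _ hq, map_zero,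
    zero_apply]
  ring

end coordinates

/-! ### Pointwise algebra of the normal form: the coordinate null frame -/

theorem rrForm_dx (f : ℝ) (u : Fin n → ℝ) (e : Coord n) : rrForm f u e dx = e.2.2 := by
  simp [rrForm, dx]

theorem rrForm_dy (f : ℝ) (u : Fin n → ℝ) (e : Coord n) (j : Fin n) :
    rrForm f u e (dy j) = 1 / 2 * (u j * e.2.2) + e.2.1 j := by
  simp [rrForm, dy, PiLp.single_apply]

/-- The second null vector of the coordinate null frame. -/
def transversal (f : ℝ) (u : Fin n → ℝ) : Coord n :=
  ((1 / 4 * ∑ i, u i * u i - f) / 2, WithLp.toLp 2 (fun i => -(u i / 2)), 1)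

theorem rrForm_transversal (f : ℝ) (u : Fin n → ℝ) (e : Coord n) :
    rrForm f u e (transversal f u) = e.1 - (1 / 4 * ∑ i, u i * u i - f) / 2 * e.2.2 := by
  have h1 : ∑ i, u i * (e.2.1 i + -(e.2.2 * (u i / 2))) = ∑ i, u i * e.2.1 i -
      1 / 2 * e.2.2 * ∑ i, u i * u i := by
    rw [Finset.mul_sum, ← Finset.sum_sub_distrib]
    exact Finset.sum_congr rfl fun i _ => by ring
  have h2 : ∑ i, -(e.2.1 i * (u i / 2)) = - (1 / 2) * ∑ i, u i * e.2.1 i := by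
    rw [Finset.mul_sum]
    exact Finset.sum_congr rfl fun i _ => by ring
  simp only [rrForm, transversal, mul_one, mul_neg]
  rw [h1, h2]
  ring

theorem sum_smul_dy (a : Fin n → ℝ) : ∑ j, a j • (dy j : Coord n) = (0, WithLp.toLp 2 a, 0) := by
  refine Prod.ext ?_ (Prod.ext ?_ ?_)
  · rw [Prod.fst_sum]; simp [dy]
  · rw [Prod.snd_sum, Prod.fst_sum]
    ext i
    simp [dy, Pi.single_apply]
  · rw [Prod.snd_sum, Prod.snd_sum]; simp [dy]

/-- The `dy j` are orthonormal and orthogonal to the null vectors `dx` and `transversal f u`, whose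
product is 1. So each coefficient is a product with the dual frame vector, the two null vectors
exchanging roles. -/
theorem rrForm_expand (f : ℝ) (u : Fin n → ℝ) (e : Coord n) :
    e = rrForm f u e (transversal f u) • dx + ∑ j, rrForm f u e (dy j) • dy j
      + rrForm f u e dx • transversal f u := by
  rw [sum_smul_dy, rrForm_transversal, rrForm_dx]
  simp only [rrForm_dy]
  refine Prod.ext ?_ (Prod.ext ?_ ?_)
  · simp [dx, transversal]
    ring
  · ext i
    simp [dx, transversal]
    ring
  · simp [dx, transversal]


/-! ### Recurrent null frames -/

/-- `(K, D, Z)` is a smooth null frame on the open set `O`, with `K` and `Z` light-like, `D`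
orthonormal, such that `∇K` and all `∇Dⱼ` are multiples of `K`. -/
structure IsRecurrentNullFrame (h : LorentzMetric n M) (O : Set M) (K : VField n M)
    (D : Fin n → VField n M) (Z : VField n M) : Prop where
  smooth_K : ∀ q ∈ O, SmoothAt K q
  smooth_D : ∀ j, ∀ q ∈ O, SmoothAt (D j) q
  smooth_Z : ∀ q ∈ O, SmoothAt Z q
  form_K_K : ∀ q ∈ O, h.form q (K q) (K q) = 0
  form_K_D : ∀ j, ∀ q ∈ O, h.form q (K q) (D j q) = 0
  form_K_Z : ∀ q ∈ O, h.form q (K q) (Z q) = 1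
  form_D_D : ∀ i j, ∀ q ∈ O, h.form q (D i q) (D j q) = if i = j then 1 else 0
  expand : ∀ q ∈ O, ∀ w, w = h.form q w (Z q) • K q + ∑ j, h.form q w (D j q) • D j q +
    h.form q w (K q) • Z q
  covDeriv_K : ∀ q ∈ O, ∀ v, covDeriv h K q v ∈ line K q
  covDeriv_D : ∀ j, ∀ q ∈ O, ∀ v, covDeriv h (D j) q v ∈ line K q

theorem IsRRCoordinates.differentiableAt_u {h : LorentzMetric n M}
    {φ : OpenPartialHomeomorph M (Coord n)} {f : Coord n → ℝ}
    {u : Fin n → Coord n → ℝ} (H : IsRRCoordinates h φ f u) {c : Coord n} (hc : c ∈ φ.target)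
    (i : Fin n) : DifferentiableAt ℝ (u i) c :=
  ((H.smooth_u i c hc).contDiffAt (φ.open_target.mem_nhds hc)).differentiableAt (by simp)

theorem fderiv_half_mul_add {g : Coord n → ℝ} {c : Coord n} (hg : DifferentiableAt ℝ g c)
    (a b : ℝ) (v : Coord n) :
    fderiv ℝ (fun c => 1 / 2 * (g c * a) + b) c v = 1 / 2 * (a * fderiv ℝ g c v) := by
  rw [fderiv_add_const, fderiv_const_mul (hg.mul_const a), fderiv_mul_const hg]
  simp

/-- Coordinate fields commute, so Koszul's formula reduces to derivatives of metric coefficients. A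
vector orthogonal to `∂/∂x` and to all `∂/∂yⱼ` is a multiple of `∂/∂x`, so only these products of
the covariant derivatives need to vanish. -/
theorem IsRRCoordinates.isRecurrentNullFrame {h : LorentzMetric n M}
    {φ : OpenPartialHomeomorph M (Coord n)} {f : Coord n → ℝ}
    {u : Fin n → Coord n → ℝ} (H : IsRRCoordinates h φ f u) (Hu : IsClosedFamily u φ.target) :
    IsRecurrentNullFrame h φ.source (coordField φ fun _ => dx)
      (fun j => coordField φ fun _ => dy j)
      (coordField φ fun c => transversal (f c) (fun i => u i c)) := by
  have expand : ∀ q ∈ φ.source, ∀ w,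
      w = h.form q w (coordField φ (fun c => transversal (f c) (fun i => u i c)) q) •
        coordField φ (fun _ => dx) q +
      ∑ j, h.form q w (coordField φ (fun _ => dy j) q) • coordField φ (fun _ => dy j) q +
      h.form q w (coordField φ (fun _ => dx) q) •
        coordField φ (fun c => transversal (f c) (fun i => u i c)) q := by
    intro q hq w
    obtain ⟨e, rfl⟩ := H.exists_coordField_eq hq w
    simp only [H.form_coordField _ _ hq]
    obtain ⟨L, hL⟩ := H.exists_linear hq
    simp only [hL]
    conv_lhs => rw [rrForm_expand (f (φ q)) (fun i => u i (φ q)) e]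
    simp only [map_add, map_sum, map_smul]
  have mem_line : ∀ q ∈ φ.source, ∀ w, h.form q w (coordField φ (fun _ => dx) q) = 0 →
      (∀ j, h.form q w (coordField φ (fun _ => dy j) q) = 0) →
      w ∈ line (coordField φ fun _ => dx) q := by
    intro q hq w h1 h2
    refine Submodule.mem_span_singleton.2
      ⟨h.form q w (coordField φ (fun c => transversal (f c) (fun i => u i c)) q), ?_⟩
    conv_rhs => rw [expand q hq w]
    simp [h1, h2]
  refine ⟨fun q hq => H.smoothAt_coordField hq contDiffAt_const,
    fun j q hq => H.smoothAt_coordField hq contDiffAt_const,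
    fun q hq => H.smoothAt_coordField hq ?_, fun q hq => ?_, fun j q hq => ?_, fun q hq => ?_,
    fun i j q hq => ?_, expand, fun q hq v => ?_, fun j q hq v => ?_⟩
  · have hc := φ.map_source hq
    have hf := (H.smooth_f _ hc).contDiffAt (φ.open_target.mem_nhds hc)
    have hu : ∀ i, ContDiffAt ℝ ∞ (u i) (φ q) := fun i =>
      (H.smooth_u i _ hc).contDiffAt (φ.open_target.mem_nhds hc)
    unfold transversal
    refine ContDiffAt.prodMk (by fun_prop) (ContDiffAt.prodMk ?_ contDiffAt_const)
    rw [contDiffAt_euclidean]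
    intro i
    simp only
    have := hu i
    fun_prop
  · rw [H.form_coordField _ _ hq, rrForm_dx]; simp [dx]
  · rw [H.form_coordField _ _ hq, rrForm_dy]; simp [dx]
  · rw [H.form_coordField _ _ hq, rrForm_transversal]; simp [dx]
  · rw [H.form_coordField _ _ hq, rrForm_dy]; simp [dy, eq_comm]
  · obtain ⟨e, rfl⟩ := H.exists_coordField_eq hq v
    refine mem_line q hq _ ?_ fun k => ?_
    · have := H.koszul_coordField e dx dx hq
      simp only [rrForm_dx] at this
      simpa using this
    · have := H.koszul_coordField e dx (dy k) hq
      have hu := H.differentiableAt_u (φ.map_source hq) k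
      simp only [rrForm_dx, rrForm_dy, fderiv_half_mul_add hu, H.dx_u k _ (φ.map_source hq),
        fderiv_fun_const] at this
      simpa [dx] using this
  · obtain ⟨e, rfl⟩ := H.exists_coordField_eq hq v
    have hj := H.differentiableAt_u (φ.map_source hq) j
    refine mem_line q hq _ ?_ fun k => ?_
    · have := H.koszul_coordField e (dy j) dx hq
      simp only [rrForm_dx, rrForm_dy, fderiv_half_mul_add hj, H.dx_u j _ (φ.map_source hq),
        fderiv_fun_const] at this
      simpa using this
    -- The product is a multiple of `∂uₖ/∂yⱼ - ∂uⱼ/∂yₖ`; this is where closedness enters.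
    · have := H.koszul_coordField e (dy j) (dy k) hq
      have hk := H.differentiableAt_u (φ.map_source hq) k
      simp only [rrForm_dy, fderiv_half_mul_add hj, fderiv_half_mul_add hk,
        Hu _ (φ.map_source hq) k j] at this
      simpa [dy] using this

/-! ### Smoothness of derivatives -/

theorem SmoothAt.neg {V : VField n M} {p : M} (hV : SmoothAt V p) : SmoothAt (-V) p :=
  ContMDiffAt.neg_section hV

theorem smoothAt_sum {ι : Type*} {s : Finset ι} {V : ι → VField n M} {p : M}
    (hV : ∀ i, SmoothAt (V i) p) : SmoothAt (fun q => ∑ i ∈ s, V i q) p :=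
  ContMDiffAt.sum_section fun i _ => hV i

theorem SmoothFunAt.eventually_mdifferentiableAt {f : M → ℝ} {p : M}
    (hf : SmoothFunAt (n := n) f p) :
    ∀ᶠ q in 𝓝 p, MDifferentiableAt (𝓡 (n + 2)) 𝓘(ℝ, ℝ) f q := by
  have hf1 : ContMDiffAt (𝓡 (n + 2)) 𝓘(ℝ, ℝ) 1 f p := hf.of_le (by simp)
  filter_upwards [(contMDiffAt_iff_contMDiffAt_nhds (by simp)).1 hf1] with q hq
  exact hq.mdifferentiableAt (by simp)

/-- Smoothness is inherited from Lie brackets: `(U f) W = [U, f W] - f [U, W]`, paired with a field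
`T` such that `h(W, T) ≠ 0` and divided by `h(W, T)`. -/
theorem smoothFunAt_dirDeriv (h : LorentzMetric n M) {U : VField n M} {f : M → ℝ} {p : M}
    (hU : SmoothAt U p) (hf : SmoothFunAt (n := n) f p) :
    SmoothFunAt (n := n) (dirDeriv U f) p := by
  obtain ⟨w, hw⟩ := exists_ne (0 : EuclideanSpace ℝ (Fin (n + 2)))
  obtain ⟨W, hW, hWw⟩ := exists_smoothAt (M := M) (p := p) w
  obtain ⟨t, ht⟩ : ∃ t, h.form p (W p) t ≠ 0 := by
    by_contra! H
    exact hw (hWw ▸ h.nondegenerate H)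
  obtain ⟨T, hT, rfl⟩ := exists_smoothAt t
  have hWT := h.smooth_apply hW hT
  have hB : SmoothAt (VectorField.mlieBracket (𝓡 (n + 2)) U (f • W) +
      -(f • VectorField.mlieBracket (𝓡 (n + 2)) U W)) p :=
    (hU.mlieBracket (hW.smul hf)).add ((hU.mlieBracket hW).smul hf).neg
  refine ((h.smooth_apply hB hT).div₀ hWT ht).congr_of_eventuallyEq ?_
  filter_upwards [hWT.continuousAt.eventually_ne ht, hf.eventually_mdifferentiableAt,
    hW.eventually_diffAt] with q hq hfq hWq
  rw [Pi.div_apply, eq_div_iff hq, Pi.add_apply, VectorField.mlieBracket_smul_right hfq hWq]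
  simp [dirDeriv]

theorem smoothFunAt_koszul (h : LorentzMetric n M) {U V T : VField n M} {p : M}
    (hU : SmoothAt U p) (hV : SmoothAt V p) (hT : SmoothAt T p) :
    SmoothFunAt (n := n) (koszul h U V T) p := by
  unfold koszul
  have h1 := smoothFunAt_dirDeriv h hU (h.smooth_apply hV hT)
  have h2 := smoothFunAt_dirDeriv h hV (h.smooth_apply hU hT)
  have h3 := smoothFunAt_dirDeriv h hT (h.smooth_apply hU hV)
  have h4 := h.smooth_apply (hU.mlieBracket hV) hT
  have h5 := h.smooth_apply (hU.mlieBracket hT) hV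
  have h6 := h.smooth_apply (hV.mlieBracket hT) hU
  exact ((((h1.add h2).sub h3).add h4).sub h5).sub h6

theorem smoothFunAt_form_nabla (h : LorentzMetric n M) {U V T : VField n M} {p : M}
    (hU : SmoothAt U p) (hV : SmoothAt V p) (hT : SmoothAt T p) :
    SmoothFunAt (n := n) (fun q => h.form q (nabla h U V q) (T q)) p := by
  have := (contMDiffAt_const (c := (1 / 2 : ℝ))).mul (smoothFunAt_koszul h hU hV hT)
  refine this.congr_of_eventuallyEq ?_
  filter_upwards [hU.eventually_diffAt, hV.eventually_diffAt, hT.eventually_diffAt]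
    with q h1 h2 h3
  simp only [nabla, Pi.mul_apply, ← two_mul_form_covDeriv h h1 h2 h3]
  ring

/-- `covDeriv` is a pointwise choice, so smoothness is recovered from the frame components, which
are halves of Koszul expressions. -/
theorem IsRecurrentNullFrame.smoothAt_nabla {h : LorentzMetric n M} {O : Set M} {K : VField n M}
    {D : Fin n → VField n M} {Z : VField n M} (H : IsRecurrentNullFrame h O K D Z)
    (hO : IsOpen O) {p : M} (hp : p ∈ O) {U V : VField n M} (hU : SmoothAt U p)
    (hV : SmoothAt V p) : SmoothAt (nabla h U V) p := by
  have hK := H.smooth_K p hp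
  have hZ := H.smooth_Z p hp
  have hD := fun j => H.smooth_D j p hp
  have h1 := ((hK.smul (smoothFunAt_form_nabla h hU hV hZ)).add
    (smoothAt_sum (s := Finset.univ) fun j =>
      (hD j).smul (smoothFunAt_form_nabla h hU hV (hD j)))).add
    (hZ.smul (smoothFunAt_form_nabla h hU hV hK))
  refine h1.congr ?_
  filter_upwards [hO.mem_nhds hp] with q hq
  exact H.expand q hq _

/-! ### Functions satisfying a linear differential equation -/

theorem IsRRCoordinates.hasDerivAt_comp {h : LorentzMetric n M}
    {φ : OpenPartialHomeomorph M (Coord n)} {f : Coord n → ℝ}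
    {u : Fin n → Coord n → ℝ} (H : IsRRCoordinates h φ f u) {g : M → ℝ} {c₀ e : Coord n} {t : ℝ}
    (hc : c₀ + t • e ∈ φ.target)
    (hg : MDifferentiableAt (𝓡 (n + 2)) 𝓘(ℝ, ℝ) g (φ.symm (c₀ + t • e))) :
    HasDerivAt (fun s : ℝ => g (φ.symm (c₀ + s • e)))
      (mvfderiv (𝓡 (n + 2)) g (φ.symm (c₀ + t • e))
        (coordField φ (fun _ => e) (φ.symm (c₀ + t • e)))) t := by
  have hq := φ.map_target hc
  have hs : MDifferentiableAt 𝓘(ℝ, Coord n) (𝓡 (n + 2)) φ.symm (c₀ + t • e) :=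
    H.mdifferentiable.mdifferentiableAt_symm hc
  have h1 := (hg.hasMFDerivAt.comp _ hs.hasMFDerivAt).hasFDerivAt
  have h2 : HasDerivAt (fun s : ℝ => c₀ + s • e) e t := by
    simpa using ((hasDerivAt_id t).smul_const e).const_add c₀
  have h3 := h1.comp_hasDerivAt t h2
  refine h3.congr_deriv ?_
  rw [H.coordField_apply _ hq, φ.right_inv hc]
  rfl

/-- On each coordinate segment issuing from `p`, `g` solves a linear homogeneous ordinary
differential equation with continuous coefficient and initial value 0, so it vanishes by Grönwall's
inequality. -/
theorem IsRRCoordinates.eventually_eq_zero {h : LorentzMetric n M}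
    {φ : OpenPartialHomeomorph M (Coord n)} {f : Coord n → ℝ}
    {u : Fin n → Coord n → ℝ} (H : IsRRCoordinates h φ f u) {p : M} (hp : p ∈ φ.source)
    {g : M → ℝ} {θ : Coord n → M → ℝ}
    (hg : ∀ᶠ q in 𝓝 p, MDifferentiableAt (𝓡 (n + 2)) 𝓘(ℝ, ℝ) g q)
    (hθ : ∀ᶠ q in 𝓝 p, ∀ e, ContinuousAt (θ e) q)
    (hgθ : ∀ᶠ q in 𝓝 p, ∀ e, mvfderiv (𝓡 (n + 2)) g q (coordField φ (fun _ => e) q) =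
      θ e q * g q) (h0 : g p = 0) : ∀ᶠ q in 𝓝 p, g q = 0 := by
  have hcp := φ.map_source hp
  have hsymm : Filter.Tendsto φ.symm (𝓝 (φ p)) (𝓝 p) := by
    simpa [φ.left_inv hp] using (φ.continuousAt_symm hcp).tendsto
  have hall := (hsymm.eventually (hg.and (hθ.and hgθ))).and (φ.open_target.mem_nhds hcp)
  obtain ⟨ε, hε, hball⟩ := Metric.eventually_nhds_iff_ball.1 hall
  have hzero : ∀ c ∈ Metric.ball (φ p) ε, g (φ.symm c) = 0 := by
    intro c hc
    set e := c - φ p with he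
    have hmem : ∀ t ∈ Set.Icc (0 : ℝ) 1, φ p + t • e ∈ Metric.ball (φ p) ε := fun t ht =>
      (convex_ball (φ p) ε).add_smul_sub_mem (Metric.mem_ball_self hε) hc ht
    have hder : ∀ t ∈ Set.Icc (0 : ℝ) 1, HasDerivAt (fun s : ℝ => g (φ.symm (φ p + s • e)))
        (θ e (φ.symm (φ p + t • e)) * g (φ.symm (φ p + t • e))) t := by
      intro t ht
      obtain ⟨⟨h1, -, h3⟩, h4⟩ := hball _ (hmem t ht)
      rw [← h3]
      exact H.hasDerivAt_comp h4 h1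
    have hcont : ContinuousOn (fun t : ℝ => θ e (φ.symm (φ p + t • e))) (Set.Icc 0 1) := by
      intro t ht
      obtain ⟨⟨-, h2, -⟩, h4⟩ := hball _ (hmem t ht)
      have h5 : ContinuousAt (fun t : ℝ => φ p + t • e) t := by fun_prop
      exact (ContinuousAt.comp (f := fun t : ℝ => φ.symm (φ p + t • e)) (h2 e)
        (ContinuousAt.comp (f := fun t : ℝ => φ p + t • e)
          (φ.continuousAt_symm h4) h5)).continuousWithinAt
    obtain ⟨C, hC⟩ := isCompact_Icc.exists_bound_of_continuousOn hcont
    have := eq_zero_of_abs_deriv_le_mul_abs_self_of_eq_zero_right (K := C)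
      (f := fun s : ℝ => g (φ.symm (φ p + s • e))) (a := 0) (b := 1)
      (f' := fun t => θ e (φ.symm (φ p + t • e)) * g (φ.symm (φ p + t • e)))
      (fun t ht => (hder t ht).continuousAt.continuousWithinAt)
      (fun t ht => (hder t (Set.Ico_subset_Icc_self ht)).hasDerivWithinAt)
      (by simpa [φ.left_inv hp] using h0)
      (fun t ht => by
        rw [norm_mul]
        exact mul_le_mul_of_nonneg_right (hC t (Set.Ico_subset_Icc_self ht)) (norm_nonneg _))
      1 (by simp)
    simpa [he] using this
  have hφ := (φ.continuousAt hp).eventually (Metric.ball_mem_nhds (φ p) hε)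
  filter_upwards [hφ, φ.open_source.mem_nhds hp] with q hq hqs
  rw [← φ.left_inv hqs]
  exact hzero _ hq

theorem IsRRCoordinates.eventually_eq_const {h : LorentzMetric n M}
    {φ : OpenPartialHomeomorph M (Coord n)} {f : Coord n → ℝ}
    {u : Fin n → Coord n → ℝ} (H : IsRRCoordinates h φ f u) {p : M} (hp : p ∈ φ.source)
    {g : M → ℝ} (hg : ∀ᶠ q in 𝓝 p, MDifferentiableAt (𝓡 (n + 2)) 𝓘(ℝ, ℝ) g q)
    (hg' : ∀ᶠ q in 𝓝 p, ∀ v, mvfderiv (𝓡 (n + 2)) g q v = 0) : ∀ᶠ q in 𝓝 p, g q = g p := by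
  have := H.eventually_eq_zero hp (g := fun q => g q - g p) (θ := fun _ _ => 0)
    (hg.mono fun q hq => hq.sub mdifferentiableAt_const)
    (Filter.Eventually.of_forall fun q e => continuousAt_const) ?_ (sub_self _)
  · exact this.mono fun q hq => sub_eq_zero.1 hq
  · filter_upwards [hg, hg'] with q hq hq' e
    rw [mvfderiv_fun_sub hq mdifferentiableAt_const, mvfderiv_const, sub_zero, hq', zero_mul]

/-! ### Parallel frames of the screen bundle -/

/-- `E` is a smooth field of vectors of `Ξ^⊥` on `O` whose classes form a parallel orthonormal frame
of the screen bundle. -/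
structure IsParallelScreenFrame (h : LorentzMetric n M) (X : VField n M) (O : Set M)
    (E : Fin n → VField n M) : Prop where
  isOpen : IsOpen O
  smooth : ∀ j, ∀ q ∈ O, SmoothAt (E j) q
  form_X : ∀ j, ∀ q ∈ O, h.form q (X q) (E j q) = 0
  form_E : ∀ i j, ∀ q ∈ O, h.form q (E i q) (E j q) = if i = j then 1 else 0
  covDeriv_mem : ∀ j, ∀ q ∈ O, ∀ v, covDeriv h (E j) q v ∈ line X q
  mem_line : ∀ q ∈ O, ∀ w ∈ perp h X q, (∀ j, h.form q w (E j q) = 0) → w ∈ line X q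

theorem mem_perp {h : LorentzMetric n M} {X : VField n M} {p : M}
    {v : TangentSpace (𝓡 (n + 2)) p} : v ∈ perp h X p ↔ h.form p (X p) v = 0 := Iff.rfl

theorem form_eq_zero_of_mem_line {h : LorentzMetric n M} {X : VField n M} {p : M}
    {v w : TangentSpace (𝓡 (n + 2)) p} (hv : v ∈ line X p) (hw : h.form p (X p) w = 0) :
    h.form p v w = 0 := by
  obtain ⟨c, rfl⟩ := Submodule.mem_span_singleton.1 hv
  simp [hw]

theorem mvfderiv_eq_zero_of_eventually {g : M → ℝ} {p : M} (hg : ∀ᶠ q in 𝓝 p, g q = 0)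
    (v : TangentSpace (𝓡 (n + 2)) p) : mvfderiv (𝓡 (n + 2)) g p v = 0 := by
  obtain ⟨U, -, rfl⟩ := exists_smoothAt v
  exact (dirDeriv_congr hg).trans (dirDeriv_const 0 p)

theorem IsRecurrentLightlike.covDeriv_mem {h : LorentzMetric n M} {X : VField n M}
    (hX : IsRecurrentLightlike h X) (p : M) (v : TangentSpace (𝓡 (n + 2)) p) :
    covDeriv h X p v ∈ line X p := by
  obtain ⟨Θ, hΘ⟩ := hX.recurrent
  exact Submodule.mem_span_singleton.2 ⟨_, (hΘ p v).symm⟩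

theorem IsRecurrentLightlike.smoothAt {h : LorentzMetric n M} {X : VField n M}
    (hX : IsRecurrentLightlike h X) (p : M) : SmoothAt X p :=
  hX.smooth.smoothAt isOpen_univ trivial

/-- `Ξ^⊥` is parallel. -/
theorem IsRecurrentLightlike.covDeriv_mem_perp {h : LorentzMetric n M} {X W : VField n M}
    (hX : IsRecurrentLightlike h X) {p : M} (hW : DiffAt W p) (hWX : ∀ᶠ q in 𝓝 p, W q ∈ perp h X q)
    (v : TangentSpace (𝓡 (n + 2)) p) : covDeriv h W p v ∈ perp h X p := by
  have h1 := mvfderiv_form h (hX.smoothAt p).diffAt hW v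
  rw [mvfderiv_eq_zero_of_eventually (g := fun q => h.form q (X q) (W q)) hWX,
    form_eq_zero_of_mem_line (hX.covDeriv_mem p v) hWX.self_of_nhds, zero_add] at h1
  exact h1.symm

/-- Adding multiples of `K` to the `D j` changes neither their products nor the fact that their
derivatives are multiples of `K`. Once the fields are orthogonal to `X`, so are their derivatives,
because `Ξ^⊥` is parallel; as `h(X, K) ≠ 0`, these derivatives are zero. -/
theorem exists_parallelScreenFrame_of_form_ne_zero {h : LorentzMetric n M} {X : VField n M}
    (hX : IsRecurrentLightlike h X) {O : Set M} (hO : IsOpen O) {K : VField n M}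
    {D : Fin n → VField n M} {Z : VField n M} (H : IsRecurrentNullFrame h O K D Z) {p : M}
    (hp : p ∈ O) (hκ : h.form p (X p) (K p) ≠ 0) :
    ∃ O' E, p ∈ O' ∧ IsParallelScreenFrame h X O' E := by
  have hXs := hX.smoothAt
  set κ : M → ℝ := fun q => h.form q (X q) (K q) with hκdef
  have hκs : ∀ q ∈ O, SmoothFunAt (n := n) κ q := fun q hq =>
    h.smooth_apply (hXs q) (H.smooth_K q hq)
  have hκc : ContinuousOn κ O := fun q hq => (hκs q hq).continuousAt.continuousWithinAt
  -- The coefficient solving `h(X, D j + α j • K) = 0`.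
  set α : Fin n → M → ℝ := fun j q => -(h.form q (X q) (D j q) / κ q) with hα
  have hαs : ∀ j, ∀ q ∈ O ∩ κ ⁻¹' {0}ᶜ, SmoothFunAt (n := n) (α j) q := fun j q hq =>
    ((h.smooth_apply (hXs q) (H.smooth_D j q hq.1)).div₀ (hκs q hq.1) hq.2).neg
  have hO' : IsOpen (O ∩ κ ⁻¹' {0}ᶜ) := hκc.isOpen_inter_preimage hO isOpen_compl_singleton
  have hKD : ∀ j, ∀ q ∈ O, h.form q (D j q) (K q) = 0 := fun j q hq => by
    rw [h.symm]; exact H.form_K_D j q hq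
  have hEs : ∀ j, ∀ q ∈ O ∩ κ ⁻¹' {0}ᶜ, SmoothAt (D j + α j • K : VField n M) q := fun j q hq =>
    (H.smooth_D j q hq.1).add ((H.smooth_K q hq.1).smul (hαs j q hq))
  have hEX : ∀ j, ∀ q ∈ O ∩ κ ⁻¹' {0}ᶜ, h.form q (X q) ((D j + α j • K : VField n M) q) = 0 := by
    intro j q hq
    have : κ q ≠ 0 := hq.2
    have h2 : h.form q (X q) (K q) = κ q := rfl
    simp only [Pi.add_apply, Pi.smul_apply', map_add, map_smul, smul_eq_mul, hα, h2]
    field_simp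
    ring
  refine ⟨O ∩ κ ⁻¹' {0}ᶜ, fun j => D j + α j • K, ⟨hp, hκ⟩, hO', hEs, hEX, fun i j q hq => ?_,
    fun j q hq v => ?_, fun q hq w hw hwE => ?_⟩
  · simp [H.form_D_D _ _ q hq.1, H.form_K_D _ q hq.1, H.form_K_K q hq.1, hKD _ q hq.1]
  · have hd := (hEs j q hq).diffAt
    have hαd : MDifferentiableAt (𝓡 (n + 2)) 𝓘(ℝ, ℝ) (α j) q :=
      (hαs j q hq).mdifferentiableAt (by simp)
    have hKd := (H.smooth_K q hq.1).diffAt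
    have h1 : covDeriv h (D j + α j • K) q v ∈ line K q := by
      rw [covDeriv_add h (H.smooth_D j q hq.1).diffAt (hKd.smul hαd), covDeriv_smul h hαd hKd]
      refine add_mem (H.covDeriv_D j q hq.1 v) (add_mem ?_ ?_)
      · exact Submodule.smul_mem _ _ (Submodule.mem_span_singleton_self _)
      · exact Submodule.smul_mem _ _ (H.covDeriv_K q hq.1 v)
    obtain ⟨μ, hμ⟩ := Submodule.mem_span_singleton.1 h1
    have h2 : h.form q (X q) (covDeriv h (D j + α j • K) q v) = 0 :=
      hX.covDeriv_mem_perp hd (Filter.mem_of_superset (hO'.mem_nhds hq) (hEX j)) v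
    have h3 : μ = 0 := by
      rw [← hμ, map_smul, smul_eq_mul] at h2
      exact (mul_eq_zero.1 h2).resolve_right hq.2
    rw [← hμ, h3, zero_smul]
    exact zero_mem _
  · have hκq : κ q ≠ 0 := hq.2
    have hXK : h.form q (X q) (K q) = κ q := rfl
    -- Removing the component along `X` makes `w'` orthogonal to `K`, hence to every `D j`. So `w'`
    -- is a multiple of `K`, and orthogonality to `X` makes it zero.
    set c := h.form q w (K q) / κ q with hc
    set w' := w - c • X q with hw'
    have hK : h.form q w' (K q) = 0 := by
      simp only [hw', map_sub, map_smul, sub_apply, smul_apply, smul_eq_mul, hXK, hc]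
      field_simp
      ring
    have hD : ∀ j, h.form q w' (D j q) = 0 := by
      intro j
      have h1 := hwE j
      have h2 := hEX j q hq
      have h3 : h.form q w' ((D j + α j • K : VField n M) q) = 0 := by
        simp only [hw', map_sub, map_smul, sub_apply, smul_apply, h1, h2, smul_zero, sub_zero]
      simpa [hK] using h3
    have hX' : h.form q w' (X q) = 0 := by
      simp only [hw', map_sub, map_smul, sub_apply, smul_apply, hX.null, smul_zero, sub_zero]
      rw [h.symm]
      exact hw
    have h1 := H.expand q hq.1 w'
    simp only [hK, hD, zero_smul, Finset.sum_const_zero, add_zero] at h1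
    have h2 : h.form q w' (Z q) = 0 := by
      rw [h1, map_smul, smul_apply, h.symm q (K q), hXK, smul_eq_mul] at hX'
      exact (mul_eq_zero.1 hX').resolve_right hκq
    rw [h2, zero_smul] at h1
    exact Submodule.mem_span_singleton.2 ⟨c, (sub_eq_zero.1 h1).symm⟩

/-- The metric is positive definite on the span of the `D j`, so a null vector orthogonal to `K` has
no component there. -/
theorem IsRecurrentNullFrame.eq_smul_of_form_eq_zero {h : LorentzMetric n M} {X : VField n M}
    (hX : IsRecurrentLightlike h X) {O : Set M} {K : VField n M}
    {D : Fin n → VField n M} {Z : VField n M} (H : IsRecurrentNullFrame h O K D Z) {q : M}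
    (hq : q ∈ O) (hκ : h.form q (X q) (K q) = 0) :
    X q = h.form q (X q) (Z q) • K q ∧ h.form q (X q) (Z q) ≠ 0 := by
  have h1 := H.expand q hq (X q)
  have h2 := hX.null q
  have h3 : ∑ j, h.form q (X q) (D j q) * h.form q (X q) (D j q) = 0 := by
    have h4 := congrArg (h.form q (X q)) h1
    simpa [map_sum, hκ, h2] using h4.symm
  have h4 : ∀ j, h.form q (X q) (D j q) = 0 := fun j =>
    mul_self_eq_zero.1 ((Finset.sum_eq_zero_iff_of_nonneg fun j _ => mul_self_nonneg _).1 h3 j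
      (Finset.mem_univ j))
  simp only [h4, hκ, zero_smul, Finset.sum_const_zero, add_zero] at h1
  exact ⟨h1, fun h5 => hX.ne_zero q (by rw [h1, h5, zero_smul])⟩

theorem IsRecurrentNullFrame.isParallelScreenFrame {h : LorentzMetric n M} {X : VField n M}
    (hX : IsRecurrentLightlike h X) {O : Set M} (hO : IsOpen O) {K : VField n M}
    {D : Fin n → VField n M} {Z : VField n M} (H : IsRecurrentNullFrame h O K D Z)
    (hκ : ∀ q ∈ O, h.form q (X q) (K q) = 0) : IsParallelScreenFrame h X O D := by
  have hKX : ∀ q ∈ O, ∀ w, w ∈ line K q → w ∈ line X q := by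
    intro q hq w hw
    obtain ⟨h1, h2⟩ := H.eq_smul_of_form_eq_zero hX hq (hκ q hq)
    obtain ⟨c, rfl⟩ := Submodule.mem_span_singleton.1 hw
    refine Submodule.mem_span_singleton.2 ⟨c * (h.form q (X q) (Z q))⁻¹, ?_⟩
    generalize h.form q (X q) (Z q) = l at h1 h2
    rw [h1, smul_smul, inv_mul_cancel_right₀ h2]
  refine ⟨hO, H.smooth_D, fun j q hq => ?_, H.form_D_D,
    fun j q hq v => hKX q hq _ (H.covDeriv_D j q hq v), fun q hq w hw hwD => hKX q hq w ?_⟩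
  · rw [(H.eq_smul_of_form_eq_zero hX hq (hκ q hq)).1]
    simp [H.form_K_D j q hq]
  · obtain ⟨h1, h2⟩ := H.eq_smul_of_form_eq_zero hX hq (hκ q hq)
    have h3 : h.form q w (K q) = 0 := by
      rw [mem_perp, h1, map_smul, smul_apply, smul_eq_mul] at hw
      rw [h.symm]
      exact (mul_eq_zero.1 hw).resolve_left h2
    refine Submodule.mem_span_singleton.2 ⟨h.form q w (Z q), ?_⟩
    conv_rhs => rw [H.expand q hq w]
    simp [hwD, h3]

theorem IsRRCoordinates.exists_parallelScreenFrame {h : LorentzMetric n M} {X : VField n M}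
    (hX : IsRecurrentLightlike h X) {φ : OpenPartialHomeomorph M (Coord n)} {f : Coord n → ℝ}
    {u : Fin n → Coord n → ℝ} (H : IsRRCoordinates h φ f u) (Hu : IsClosedFamily u φ.target)
    {p : M} (hp : p ∈ φ.source) : ∃ O E, p ∈ O ∧ IsParallelScreenFrame h X O E := by
  have HF := H.isRecurrentNullFrame Hu
  set K : VField n M := coordField φ fun _ => dx with hK
  set D : Fin n → VField n M := fun j => coordField φ fun _ => dy j with hD
  set Z : VField n M := coordField φ fun c => transversal (f c) (fun i => u i c) with hZ
  by_cases hκ : h.form p (X p) (K p) = 0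
  swap
  · exact exists_parallelScreenFrame_of_form_ne_zero hX φ.open_source HF hp hκ
  have hXs := hX.smoothAt
  have hXZ : ∀ᶠ q in 𝓝 p, h.form q (X q) (Z q) ≠ 0 :=
    (h.smooth_apply (hXs p) (HF.smooth_Z p hp)).continuousAt.eventually_ne
      (HF.eq_smul_of_form_eq_zero hX hp hκ).2
  have hsource := φ.open_source.mem_nhds hp
  have hzero : ∀ᶠ q in 𝓝 p, h.form q (X q) (K q) = 0 := by
    -- The coefficient is the sum of the recurrence forms of `X` and `K`. Nothing is known about the
    -- regularity of these forms, so they are written as quotients of products with `Z`, which are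
    -- visibly continuous where `h(X, Z) ≠ 0`.
    refine H.eventually_eq_zero hp (θ := fun e q =>
      h.form q (nabla h (coordField φ fun _ => e) X q) (Z q) / h.form q (X q) (Z q) +
      h.form q (nabla h (coordField φ fun _ => e) K q) (Z q)) ?_ ?_ ?_ hκ
    · exact (h.smooth_apply (hXs p) (HF.smooth_K p hp)).eventually_mdifferentiableAt
    · filter_upwards [hXZ, hsource] with q hq hqs e
      have he : SmoothAt (coordField φ fun _ => e) q := H.smoothAt_coordField hqs contDiffAt_const
      have hZq := HF.smooth_Z q hqs
      exact ((smoothFunAt_form_nabla h he (hXs q) hZq).continuousAt.div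
        (h.smooth_apply (hXs q) hZq).continuousAt hq).add
        (smoothFunAt_form_nabla h he (HF.smooth_K q hqs) hZq).continuousAt
    · filter_upwards [hXZ, hsource] with q hq hqs e
      rw [mvfderiv_form h (hXs q).diffAt (HF.smooth_K q hqs).diffAt]
      simp only [nabla]
      obtain ⟨a, ha⟩ := Submodule.mem_span_singleton.1
        (hX.covDeriv_mem q (coordField φ (fun _ => e) q))
      obtain ⟨b, hb⟩ := Submodule.mem_span_singleton.1
        (HF.covDeriv_K q hqs (coordField φ (fun _ => e) q))
      rw [← ha, ← hb]
      simp only [map_smul, smul_apply, smul_eq_mul, HF.form_K_Z q hqs]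
      field_simp
  obtain ⟨O, hO, hOo, hpO⟩ := mem_nhds_iff.1 (Filter.inter_mem hzero hsource)
  refine ⟨O, D, hpO, ?_⟩
  have HF' : IsRecurrentNullFrame h O K D Z :=
    ⟨fun q hq => HF.smooth_K q (hO hq).2, fun j q hq => HF.smooth_D j q (hO hq).2,
      fun q hq => HF.smooth_Z q (hO hq).2, fun q hq => HF.form_K_K q (hO hq).2,
      fun j q hq => HF.form_K_D j q (hO hq).2, fun q hq => HF.form_K_Z q (hO hq).2,
      fun i j q hq => HF.form_D_D i j q (hO hq).2, fun q hq => HF.expand q (hO hq).2,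
      fun q hq => HF.covDeriv_K q (hO hq).2, fun j q hq => HF.covDeriv_D j q (hO hq).2⟩
  exact HF'.isParallelScreenFrame hX hOo fun q hq => (hO hq).1

/-! ### The curvature condition -/

theorem IsParallelScreenFrame.form_nabla {h : LorentzMetric n M} {X : VField n M} {O : Set M}
    {E : Fin n → VField n M} (H : IsParallelScreenFrame h X O E) {U W : VField n M} {p : M}
    (hp : p ∈ O) (hW : DiffAt W p) (hWX : W p ∈ perp h X p) (j : Fin n) :
    h.form p (nabla h U W p) (E j p) = dirDeriv U (fun q => h.form q (W q) (E j q)) p := by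
  have h1 := mvfderiv_form h hW (H.smooth j p hp).diffAt (U p)
  rw [h.symm p (W p), form_eq_zero_of_mem_line (H.covDeriv_mem j p hp (U p)) hWX, add_zero] at h1
  exact h1.symm

/-- By `form_nabla`, `∇` acts on the screen components of fields in `Ξ^⊥` as plain differentiation,
whose curvature is zero; an element of `Ξ^⊥` with vanishing screen components lies in `Ξ`. -/
theorem IsParallelScreenFrame.curvature_mem {h : LorentzMetric n M} {X : VField n M}
    (hX : IsRecurrentLightlike h X) {O : Set M} {E : Fin n → VField n M}
    (H : IsParallelScreenFrame h X O E) {U V W : VField n M} {p : M} (hp : p ∈ O)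
    (hU : SmoothAt U p) (hV : SmoothAt V p) (hW : SmoothAt W p)
    (hUW : SmoothAt (nabla h U W) p) (hVW : SmoothAt (nabla h V W) p)
    (hWX : ∀ᶠ q in 𝓝 p, W q ∈ perp h X q) : curvature h U V W p ∈ line X p := by
  have hperp : ∀ U : VField n M, ∀ᶠ q in 𝓝 p, nabla h U W q ∈ perp h X q := by
    intro U
    filter_upwards [hWX.eventually_nhds, hW.eventually_diffAt] with q hq hWq
    exact hX.covDeriv_mem_perp hWq hq _
  have hcoeff : ∀ (U : VField n M) j, (fun q => h.form q (nabla h U W q) (E j q)) =ᶠ[𝓝 p]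
      dirDeriv U (fun q => h.form q (W q) (E j q)) := by
    intro U j
    filter_upwards [hWX, hW.eventually_diffAt, H.isOpen.mem_nhds hp] with q hq hWq hqO
    exact H.form_nabla hqO hWq hq j
  refine H.mem_line p hp _ ?_ fun j => ?_
  · refine sub_mem (sub_mem ?_ ?_) ?_
    · exact hX.covDeriv_mem_perp hVW.diffAt (hperp V) _
    · exact hX.covDeriv_mem_perp hUW.diffAt (hperp U) _
    · exact (hperp _).self_of_nhds
  · have hc := h.smooth_apply hW (H.smooth j p hp)
    have h1 := H.form_nabla (U := U) hp hVW.diffAt (hperp V).self_of_nhds j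
    have h2 := H.form_nabla (U := V) hp hUW.diffAt (hperp U).self_of_nhds j
    have h3 := H.form_nabla (U := VectorField.mlieBracket (𝓡 (n + 2)) U V) hp hW.diffAt
      hWX.self_of_nhds j
    rw [dirDeriv_congr (hcoeff V j)] at h1
    rw [dirDeriv_congr (hcoeff U j)] at h2
    rw [dirDeriv_mlieBracket hU hV hc ((smoothFunAt_dirDeriv h hU hc).mdifferentiableAt (by simp))
      ((smoothFunAt_dirDeriv h hV hc).mdifferentiableAt (by simp))] at h3
    simp only [curvature, map_sub, sub_apply, h1, h2, h3]
    ring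

/-! ### Screen coordinates of a parallel field along a curve -/

section along

variable {h : LorentzMetric n M} {X : VField n M} {O : Set M} {E : Fin n → VField n M}

/-- The components of the class of the tangent vector `w` in the screen frame `E`. -/
def screenCoord (h : LorentzMetric n M) (E : Fin n → VField n M)
    (w : TangentBundle (𝓡 (n + 2)) M) (j : Fin n) : ℝ :=
  h.form w.proj w.2 (E j w.proj)

/-- The derivative is `h(w, E k) + h(W, ∇ E k)`. Both terms pair an element of `Ξ` with an element
of `Ξ^⊥`. -/
theorem IsParallelScreenFrame.hasDerivAt_screenCoord (H : IsParallelScreenFrame h X O E)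
    {W : ℝ → TangentBundle (𝓡 (n + 2)) M} {t : ℝ}
    (hγ : MDifferentiableAt 𝓘(ℝ, ℝ) (𝓡 (n + 2)) (fun s => (W s).proj) t) (hO : (W t).proj ∈ O)
    (hperp : (W t).2 ∈ perp h X (W t).proj) {w : TangentSpace (𝓡 (n + 2)) (W t).proj}
    (hw : w ∈ line X (W t).proj) (hcov : HasCovDerivAlong h W t w) (k : Fin n) :
    HasDerivAt (fun s => screenCoord h E (W s) k) 0 t := by
  obtain ⟨m, a, F, ha, hF, hWF, hwF⟩ := hcov
  set v := mfderiv 𝓘(ℝ, ℝ) (𝓡 (n + 2)) (fun s => (W s).proj) t (1 : ℝ) with hv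
  have hEk := (H.smooth k _ hO).diffAt
  have hG : ∀ j, HasDerivAt (fun s => h.form (W s).proj (F j (W s).proj) (E k (W s).proj))
      (h.form (W t).proj (covDeriv h (F j) (W t).proj v) (E k (W t).proj) +
        h.form (W t).proj (F j (W t).proj) (covDeriv h (E k) (W t).proj v)) t := by
    intro j
    have hd := h.diff_apply (hF j).diffAt hEk
    have h1 : HasDerivAt (fun s => h.form (W s).proj (F j (W s).proj) (E k (W s).proj))
        ((show ℝ →L[ℝ] ℝ from (mfderiv (𝓡 (n + 2)) 𝓘(ℝ, ℝ)
          (fun q => h.form q (F j q) (E k q)) (W t).proj).comp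
          (mfderiv 𝓘(ℝ, ℝ) (𝓡 (n + 2)) (fun s => (W s).proj) t)) 1) t :=
      HasFDerivAt.hasDerivAt
        (hasMFDerivAt_iff_hasFDerivAt.1 (hd.hasMFDerivAt.comp t hγ.hasMFDerivAt))
    refine h1.congr_deriv ?_
    rw [← mvfderiv_form h (hF j).diffAt hEk v]
    rfl
  have hsum : HasDerivAt (fun s => ∑ j, a j s *
      h.form (W s).proj (F j (W s).proj) (E k (W s).proj)) _ t :=
    HasDerivAt.fun_sum fun j _ => (ha j).hasDerivAt.mul (hG j)
  have heq : (fun s => screenCoord h E (W s) k) =ᶠ[𝓝 t] fun s => ∑ j, a j s *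
      h.form (W s).proj (F j (W s).proj) (E k (W s).proj) := by
    filter_upwards [hWF] with s hs
    rw [screenCoord, hs]
    simp
  refine (hsum.congr_of_eventuallyEq heq).congr_deriv ?_
  have h1 : h.form (W t).proj w (E k (W t).proj) = 0 :=
    form_eq_zero_of_mem_line hw (H.form_X k _ hO)
  have h2 : h.form (W t).proj (W t).2 (covDeriv h (E k) (W t).proj v) = 0 := by
    rw [h.symm]
    exact form_eq_zero_of_mem_line (H.covDeriv_mem k _ hO v) hperp
  rw [hwF] at h1
  rw [hWF.self_of_nhds] at h2
  simp only [map_sum, sum_apply, map_add, add_apply, map_smul, smul_apply, smul_eq_mul] at h1 h2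
  rw [← add_zero (0 : ℝ)]
  nth_rewrite 2 [← h1]
  rw [← h2, ← Finset.sum_add_distrib]
  exact Finset.sum_congr rfl fun j _ => by ring

theorem continuousOn_screenCoord {W : ℝ → TangentBundle (𝓡 (n + 2)) M} {s : Set ℝ}
    (hW : ContinuousOn W s) (k : Fin n) (hE : ∀ t ∈ s, SmoothAt (E k) (W t).proj) :
    ContinuousOn (fun t => screenCoord h E (W t) k) s := by
  intro t ht
  have hproj : ContinuousWithinAt (fun s => (W s).proj) s t :=
    (FiberBundle.continuous_proj (EuclideanSpace ℝ (Fin (n + 2)))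
      (TangentSpace (𝓡 (n + 2)) (M := M))).continuousAt.comp_continuousWithinAt (hW t ht)
  have h1 := ContinuousAt.comp_continuousWithinAt (f := fun s => (W s).proj)
    (h.smooth (W t).proj).continuousAt hproj
  have h2 := ContinuousAt.comp_continuousWithinAt (f := fun s => (W s).proj)
    (hE t ht).continuousAt hproj
  have h3 := ContinuousWithinAt.clm_bundle_apply₂ (F₃ := ℝ) (E₃ := fun _ : M => ℝ)
    (b := fun s => (W s).proj) (ψ := fun s => h.form (W s).proj)
    (v := fun s => (W s).2) (w := fun s => E k (W s).proj) h1 (hW t ht) h2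
  exact ((FiberBundle.continuousWithinAt_totalSpace _ _).1 h3).2

theorem IsParallelScreenFrame.sub_mem_line (H : IsParallelScreenFrame h X O E) {q : M}
    (hq : q ∈ O) {w : TangentSpace (𝓡 (n + 2)) q} (hw : w ∈ perp h X q) :
    w - ∑ j, h.form q w (E j q) • E j q ∈ line X q := by
  refine H.mem_line q hq _ (sub_mem hw (sum_mem fun j _ => ?_)) fun j => ?_
  · exact Submodule.smul_mem _ _ (H.form_X j q hq)
  · simp [H.form_E _ _ q hq]

theorem IsParallelScreenFrame.sum_form (H : IsParallelScreenFrame h X O E) {q : M}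
    (hq : q ∈ O) {w y : TangentSpace (𝓡 (n + 2)) q} (hw : w ∈ perp h X q) (hy : y ∈ perp h X q) :
    h.form q (∑ j, h.form q w (E j q) • E j q) y = h.form q w y := by
  have := form_eq_zero_of_mem_line (H.sub_mem_line hq hw) hy
  rw [map_sub, sub_apply, sub_eq_zero] at this
  exact this.symm

/-- This makes the transition matrices between parallel frames locally constant, which is what
permits discrete fibres in `screenCore`. -/
theorem IsParallelScreenFrame.mvfderiv_form_form {O' : Set M} {E' : Fin n → VField n M}
    (H : IsParallelScreenFrame h X O E) (H' : IsParallelScreenFrame h X O' E') (i j : Fin n)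
    {q : M} (hq : q ∈ O) (hq' : q ∈ O') (v : TangentSpace (𝓡 (n + 2)) q) :
    mvfderiv (𝓡 (n + 2)) (fun q => h.form q (E i q) (E' j q)) q v = 0 := by
  rw [mvfderiv_form h (H.smooth i q hq).diffAt (H'.smooth j q hq').diffAt,
    form_eq_zero_of_mem_line (H.covDeriv_mem i q hq v) (H'.form_X j q hq'), h.symm,
    form_eq_zero_of_mem_line (H'.covDeriv_mem j q hq' v) (H.form_X i q hq), add_zero]

end along

/-! ### Piecewise differentiable curves -/

theorem IsPiecewiseC1.exists_finite {p q : M} {γ : Path p q} (hγ : IsPiecewiseC1 (n := n) γ) :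
    ∃ F : Set ℝ, F.Finite ∧ ∀ t ∈ Set.Ioo (0 : ℝ) 1 \ F,
      MDifferentiableAt 𝓘(ℝ, ℝ) (𝓡 (n + 2)) γ.extend t := by
  obtain ⟨m, τ, -, h0, h1, hC⟩ := hγ
  refine ⟨τ '' Set.Iic m, (Set.finite_Iic m).image τ, fun t ht => ?_⟩
  have key : ∀ k ≤ m, t < τ k → ∃ i < k, τ i < t ∧ t < τ (i + 1) := by
    intro k
    induction k with
    | zero => intro _ hk; rw [h0] at hk; exact absurd ht.1.1 (not_lt.2 hk.le)
    | succ k ih =>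
      intro hk hkt
      rcases lt_or_ge t (τ k) with hlt | hge
      · obtain ⟨i, hi, hi'⟩ := ih (by omega) hlt
        exact ⟨i, by omega, hi'⟩
      · refine ⟨k, by omega, lt_of_le_of_ne hge fun heq => ht.2 ⟨k, ?_, heq⟩, hkt⟩
        exact Set.mem_Iic.2 (by omega)
  obtain ⟨i, hi, hi1, hi2⟩ := key m le_rfl (by rw [h1]; exact ht.1.2)
  exact ((hC i hi t ⟨hi1.le, hi2.le⟩).contMDiffAt (Icc_mem_nhds hi1 hi2)).mdifferentiableAt
    (by simp)

theorem eq_of_hasDerivAt_zero_off_finite {g : ℝ → ℝ} {a b : ℝ} {F : Set ℝ} (hF : F.Finite)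
    (hg : ContinuousOn g (Set.uIcc a b))
    (hg' : ∀ t ∈ Set.Ioo (min a b) (max a b) \ F, HasDerivAt g 0 t) : g b = g a := by
  have := MeasureTheory.integral_eq_of_hasDerivAt_off_countable g (fun _ => 0) hF.countable hg hg'
    (by simp)
  rw [intervalIntegral.integral_zero] at this
  exact (sub_eq_zero.1 this.symm)

/-- The components are continuous and have zero derivative except at the exceptional times of `W`
and the break points of `γ`. There are finitely many of these, so the fundamental theorem of
calculus still applies. -/
theorem IsScreenParallelAlong.eventually_screenCoord_eq {h : LorentzMetric n M} {X : VField n M}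
    {O : Set M} {E : Fin n → VField n M} (H : IsParallelScreenFrame h X O E) {p q : M}
    {γ : Path p q} (hγ : IsPiecewiseC1 (n := n) γ) {W : ℝ → TangentBundle (𝓡 (n + 2)) M}
    (hW : IsScreenParallelAlong h X γ W) {t₀ : unitInterval} (ht₀ : γ t₀ ∈ O) :
    ∀ᶠ t : unitInterval in 𝓝 t₀, screenCoord h E (W t) = screenCoord h E (W t₀) := by
  obtain ⟨hproj, hcont, hperp, F, hF, hpar⟩ := hW
  obtain ⟨F', hF', hdiff⟩ := hγ.exists_finite
  have hnhds : γ.extend ⁻¹' O ∈ 𝓝 (t₀ : ℝ) := by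
    refine γ.continuous_extend.continuousAt (H.isOpen.mem_nhds ?_)
    rwa [γ.extend_apply t₀.2]
  obtain ⟨ε, hε, hball⟩ := Metric.mem_nhds_iff.1 hnhds
  filter_upwards [continuous_subtype_val.continuousAt (Metric.ball_mem_nhds (t₀ : ℝ) hε)]
    with t ht
  have hsub1 : Set.uIcc (t₀ : ℝ) t ⊆ Set.Icc 0 1 :=
    (Set.ordConnected_Icc).uIcc_subset t₀.2 t.2
  have hsub2 : Set.uIcc (t₀ : ℝ) t ⊆ γ.extend ⁻¹' O := by
    refine Set.Subset.trans ?_ hball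
    have : Set.OrdConnected (Metric.ball (t₀ : ℝ) ε) := by
      rw [Real.ball_eq_Ioo]; exact Set.ordConnected_Ioo
    exact this.uIcc_subset (Metric.mem_ball_self hε) ht
  have hO : ∀ s ∈ Set.uIcc (t₀ : ℝ) t, (W s).proj ∈ O := fun s hs => by
    rw [hproj s (hsub1 hs)]; exact hsub2 hs
  ext k
  refine eq_of_hasDerivAt_zero_off_finite (hF.union hF')
    (continuousOn_screenCoord (hcont.mono hsub1) k fun s hs => H.smooth k _ (hO s hs))
    fun s hs => ?_
  have hsI : s ∈ Set.uIcc (t₀ : ℝ) t := Set.Ioo_subset_Icc_self hs.1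
  have hs01 : s ∈ Set.Ioo (0 : ℝ) 1 :=
    ⟨(le_min t₀.2.1 t.2.1).trans_lt hs.1.1, hs.1.2.trans_le (max_le t₀.2.2 t.2.2)⟩
  obtain ⟨w, hw, hcov⟩ := hpar s ⟨hs01, fun hsF => hs.2 (Or.inl hsF)⟩
  refine H.hasDerivAt_screenCoord ?_ (hO s hsI) (hperp s (hsub1 hsI)) hw hcov k
  refine (hdiff s ⟨hs01, fun hsF => hs.2 (Or.inr hsF)⟩).congr_of_eventuallyEq ?_
  filter_upwards [Icc_mem_nhds hs01.1 hs01.2] with r hr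
  exact hproj r hr

/-! ### The covering space of screen vectors -/

/-- The coordinate space `ℝⁿ` with the discrete topology. -/
def DiscreteCoord (n : ℕ) : Type := Fin n → ℝ

instance : TopologicalSpace (DiscreteCoord n) := ⊥

instance : DiscreteTopology (DiscreteCoord n) := ⟨rfl⟩

section core

variable (h : LorentzMetric n M) (X : VField n M) (O : M → Set M) (E : M → Fin n → VField n M)

/-- The components in the frame `E'` of the class with the components `v` in the frame `E`. -/
def screenChange (E E' : Fin n → VField n M) (q : M) (v : DiscreteCoord n) : DiscreteCoord n :=
  fun k => h.form q (∑ l, v l • E l q) (E' k q)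

variable {h X}

theorem IsParallelScreenFrame.sum_mem_perp {O : Set M} {E : Fin n → VField n M}
    (H : IsParallelScreenFrame h X O E) {q : M} (hq : q ∈ O) (v : Fin n → ℝ) :
    ∑ l, v l • E l q ∈ perp h X q :=
  sum_mem fun j _ => Submodule.smul_mem _ _ (H.form_X j q hq)

theorem IsParallelScreenFrame.screenChange_screenCoord {O O' : Set M} {E E' : Fin n → VField n M}
    (H : IsParallelScreenFrame h X O E) (H' : IsParallelScreenFrame h X O' E')
    {w : TangentBundle (𝓡 (n + 2)) M} (hq : w.proj ∈ O) (hq' : w.proj ∈ O')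
    (hw : w.2 ∈ perp h X w.proj) :
    screenChange h E E' w.proj (screenCoord h E w) = screenCoord h E' w :=
  funext fun k => H.sum_form hq hw (H'.form_X k _ hq')

/-- The bundle over `M` with the fibres of the screen bundle, with discrete topology, glued
by parallel frames. -/
def screenCore (hmem : ∀ p, p ∈ O p) (hE : ∀ p, IsParallelScreenFrame h X (O p) (E p))
    (hconst : ∀ p p' i j q, q ∈ O p → q ∈ O p' → ∀ᶠ q' in 𝓝 q,
      h.form q' (E p i q') (E p' j q') = h.form q (E p i q) (E p' j q)) :
    FiberBundleCore M M (DiscreteCoord n) where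
  baseSet := O
  isOpen_baseSet p := (hE p).isOpen
  indexAt := id
  mem_baseSet_at := hmem
  coordChange i j q v := screenChange h (E i) (E j) q v
  coordChange_self i q hq v := by
    funext k
    simp only [screenChange, map_sum, map_smul, sum_apply,
      smul_apply, (hE i).form_E _ _ q hq, smul_eq_mul, mul_ite, mul_one, mul_zero]
    exact (Finset.sum_ite_eq' Finset.univ k v).trans (if_pos (Finset.mem_univ k))
  continuousOn_coordChange i j := by
    rintro ⟨q, v⟩ ⟨⟨hi, hj⟩, -⟩
    refine ContinuousAt.continuousWithinAt ?_
    have : (fun p : M × DiscreteCoord n => screenChange h (E i) (E j) p.1 p.2) =ᶠ[𝓝 (q, v)]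
        fun _ => screenChange h (E i) (E j) q v := by
      rw [nhds_prod_eq, nhds_discrete (DiscreteCoord n)]
      have h1 : ∀ᶠ q' in 𝓝 q, ∀ l k, h.form q' (E i l q') (E j k q') =
          h.form q (E i l q) (E j k q) :=
        Filter.eventually_all.2 fun l => Filter.eventually_all.2 fun k =>
          hconst i j l k q hi hj
      have h2 : ∀ᶠ v' in pure v, v' = v := Filter.eventually_pure.2 rfl
      filter_upwards [h1.prod_mk h2] with p hp
      funext k
      simp [screenChange, hp.1, hp.2]
    exact continuousAt_const.congr this.symm
  coordChange_comp i j k q hq v := by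
    funext m
    -- Expanding in the frame `E j` alters the vector only by an element of `Ξ`, which pairs to zero
    -- with `E k m`.
    exact (hE j).sum_form hq.1.2 ((hE i).sum_mem_perp hq.1.1 v) ((hE k).form_X m q hq.2)

end core

/-- The screen components of `W` lift `γ` to the covering space `screenCore`. A null-homotopic loop
lifts to a closed path, so `v` and `v'` have the same components. -/
theorem IsScreenParallelAlong.sub_mem_line {h : LorentzMetric n M} {X : VField n M}
    {O : M → Set M} {E : M → Fin n → VField n M}
    (hmem : ∀ p, p ∈ O p) (hE : ∀ p, IsParallelScreenFrame h X (O p) (E p))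
    (hconst : ∀ p p' i j q, q ∈ O p → q ∈ O p' → ∀ᶠ q' in 𝓝 q,
      h.form q' (E p i q') (E p' j q') = h.form q (E p i q) (E p' j q))
    {p : M} {γ : Path p p} (hγ : IsPiecewiseC1 (n := n) γ) (hγ0 : γ.Homotopic (Path.refl p))
    {W : ℝ → TangentBundle (𝓡 (n + 2)) M} (hW : IsScreenParallelAlong h X γ W)
    {v v' : perp h X p} (h0 : W 0 = ⟨p, v⟩) (h1 : W 1 = ⟨p, v'⟩) :
    (v - v' : TangentSpace (𝓡 (n + 2)) p) ∈ line X p := by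
  set Z := screenCore O E hmem hE hconst with hZ
  have cov : IsCoveringMap (Bundle.TotalSpace.proj (F := DiscreteCoord n) (E := Z.Fiber)) :=
    FiberBundle.isCoveringMap
  -- Over `γ t` the fibre coordinates are those of the frame attached to `γ t` itself, since
  -- `indexAt` is the identity; continuity is checked in the fixed frame attached to `γ t₀`.
  set Γ : unitInterval → Z.TotalSpace := fun t => ⟨γ t, screenCoord h (E (γ t)) (W t)⟩ with hΓ
  have hproj : ∀ t : unitInterval, (W t).proj = γ t := fun t => by
    rw [hW.1 t t.2, γ.extend_apply t.2]
  have hcont : Continuous Γ := by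
    refine continuous_iff_continuousAt.2 fun t₀ =>
      (FiberBundle.continuousAt_totalSpace _ _).2 ⟨γ.continuous.continuousAt, ?_⟩
    have hev : (fun t => ((FiberBundle.trivializationAt (DiscreteCoord n) Z.Fiber
        (Γ t₀).proj) (Γ t)).2) =ᶠ[𝓝 t₀] fun _ => screenCoord h (E (γ t₀)) (W t₀) := by
      filter_upwards [hW.eventually_screenCoord_eq (hE (γ t₀)) hγ (hmem (γ t₀)),
        γ.continuous.continuousAt ((hE (γ t₀)).isOpen.mem_nhds (hmem (γ t₀)))] with t ht htO
      have h2 := (hE (γ t)).screenChange_screenCoord (hE (γ t₀)) (w := W t)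
        (by rw [hproj]; exact hmem _) (by rw [hproj]; exact htO) (hW.2.2.1 t t.2)
      rw [hproj t] at h2
      exact h2.trans ht
    exact continuousAt_const.congr hev.symm
  have e0 : Γ = cov.liftPath γ.toContinuousMap (Γ 0) rfl :=
    (cov.eq_liftPath_iff _).2 ⟨hcont, rfl, rfl⟩
  have hbase : p = (Γ 0).proj := γ.source.symm
  have e1 := cov.liftPath_apply_one_eq_of_homotopicRel hγ0 (Γ 0) rfl hbase
  have e2 : cov.liftPath (Path.refl p).toContinuousMap (Γ 0) hbase 1 = Γ 0 := by
    have := cov.liftPath_const hbase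
    exact congrArg (fun f : C(unitInterval, Z.TotalSpace) => f 1) this
  have e3 : Γ 1 = Γ 0 := (congrFun e0 1).trans (e1.trans e2)
  -- The endpoints of `Γ` lie over `γ 0` and `γ 1`, equal to `p` only propositionally; passing to
  -- the frame at `p` avoids transporting along these equalities.
  have e4 : screenCoord h (E p) (W 0) = screenCoord h (E p) (W 1) := by
    have key : ∀ t : unitInterval, γ t = p →
        screenChange h (E (Γ t).proj) (E p) (Γ t).proj (Γ t).2 = screenCoord h (E p) (W t) := by
      intro t ht
      have h2 := (hE (γ t)).screenChange_screenCoord (hE p) (w := W t)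
        (by rw [hproj]; exact hmem _) (by rw [hproj, ht]; exact hmem _) (hW.2.2.1 t t.2)
      rwa [hproj t] at h2
    have k0 := key 0 γ.source
    have k1 := key 1 γ.target
    rw [e3] at k1
    exact k0.symm.trans k1
  rw [h0, h1] at e4
  refine (hE p).mem_line p (hmem p) _ (sub_mem v.2 v'.2) fun j => ?_
  have := congrFun e4 j
  simp only [screenCoord] at this
  rw [map_sub, sub_apply, this, sub_self]

theorem id_mem_restrictedScreenHolonomy (h : LorentzMetric n M) (X : VField n M) (p : M) :
    LinearMap.id ∈ restrictedScreenHolonomy h X p := by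
  refine ⟨Path.refl p, ⟨1, fun i => i, fun i j hij => by simpa using hij, by simp, by simp,
    fun i _ => ?_⟩, Path.Homotopic.refl _, fun v => ⟨v, fun _ => ⟨p, v⟩, ⟨?_, ?_, ?_, ?_⟩, rfl, rfl,
      rfl⟩⟩
  · have : ((Path.refl p).extend : ℝ → M) = fun _ => p := by ext; simp
    rw [this]
    exact contMDiffOn_const
  · intro t _
    simp
  · exact continuousOn_const
  · exact fun _ _ => v.2
  -- Along the constant path, the constant vector is the value of one fixed extension `V` with
  -- coefficient 1, and its derivative is `∇_0 V = 0`.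
  · refine ⟨∅, Set.finite_empty, fun t _ => ⟨0, zero_mem _, ?_⟩⟩
    obtain ⟨V, hV, hVv⟩ := exists_smoothAt (v : TangentSpace (𝓡 (n + 2)) p)
    refine ⟨1, fun _ _ => 1, fun _ => V, fun _ => differentiableAt_const _, fun _ => hV,
      Filter.Eventually.of_forall fun s => by simp [hVv], ?_⟩
    have : mfderiv 𝓘(ℝ, ℝ) (𝓡 (n + 2)) (fun _ : ℝ => p) t = 0 := mfderiv_const
    simp only [this, zero_smul, deriv_const, one_smul, zero_add, Finset.univ_unique,
      Finset.sum_singleton]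
    exact (covDeriv_zero_right h hV.diffAt).symm

end LorentzScreen

end

open LorentzScreen in
theorem proposition10 {n : ℕ} {M : Type*} [TopologicalSpace M] [T2Space M]
    [SecondCountableTopology M] [ChartedSpace (EuclideanSpace ℝ (Fin (n + 2))) M]
    [IsManifold (𝓡 (n + 2)) ∞ M]
    (h : LorentzScreen.LorentzMetric n M) (X : LorentzScreen.VField n M)
    (hX : LorentzScreen.IsRecurrentLightlike h X)
    (hcurv : LorentzScreen.HasLightlikeHypersurfaceCurvature h X)
    (hcoord : ∀ o : M, ∃ (φ : OpenPartialHomeomorph M (LorentzScreen.Coord n))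
      (f : LorentzScreen.Coord n → ℝ) (u : Fin n → LorentzScreen.Coord n → ℝ),
      o ∈ φ.source ∧ LorentzScreen.IsRRCoordinates h φ f u ∧
        LorentzScreen.IsClosedFamily u φ.target) :
    LorentzScreen.IsPrWave h X ∧ LorentzScreen.HasTrivialScreenHolonomy h X := by
  have hframe : ∀ p : M, ∃ O E, p ∈ O ∧ IsParallelScreenFrame h X O E := fun p => by
    obtain ⟨φ, f, u, hp, H, Hu⟩ := hcoord p
    exact H.exists_parallelScreenFrame hX Hu hp
  choose O E hmem hE using hframe
  refine ⟨⟨hX, fun A hA U V W hU hV hW hWX p hp => ?_⟩, fun p => ?_⟩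
  · obtain ⟨φ, f, u, hpφ, H, Hu⟩ := hcoord p
    have HF := H.isRecurrentNullFrame Hu
    have hUp := hU.smoothAt hA hp
    have hVp := hV.smoothAt hA hp
    have hWp := hW.smoothAt hA hp
    exact (hE p).curvature_mem hX (hmem p) hUp hVp hWp
      (HF.smoothAt_nabla φ.open_source hpφ hUp hWp) (HF.smoothAt_nabla φ.open_source hpφ hVp hWp)
      (Filter.mem_of_superset (hA.mem_nhds hp) hWX)
  · have hconst : ∀ p p' i j q, q ∈ O p → q ∈ O p' → ∀ᶠ q' in 𝓝 q,
        h.form q' (E p i q') (E p' j q') = h.form q (E p i q) (E p' j q) := by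
      intro p p' i j q hq hq'
      obtain ⟨φ, f, u, hqφ, H, -⟩ := hcoord q
      refine H.eventually_eq_const hqφ
        (h.smooth_apply ((hE p).smooth i q hq)
          ((hE p').smooth j q hq')).eventually_mdifferentiableAt ?_
      filter_upwards [(hE p).isOpen.mem_nhds hq, (hE p').isOpen.mem_nhds hq'] with r hr hr' v
      exact (hE p).mvfderiv_form_form (hE p') i j hr hr' v
    -- The constant loop realises the identity, so parallel transport need not be constructed along
    -- other loops: any displacement that occurs only has to be shown trivial.
    refine Set.eq_singleton_iff_unique_mem.2 ⟨id_mem_restrictedScreenHolonomy h X p, ?_⟩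
    rintro P ⟨γ, hγ, hγ0, hP⟩
    refine LinearMap.ext fun x => ?_
    obtain ⟨v, rfl⟩ := Submodule.Quotient.mk_surjective _ x
    obtain ⟨v', W, hW, h0, h1, hPv⟩ := hP v
    rw [hPv, LinearMap.id_apply, eq_comm, Submodule.Quotient.eq]
    exact hW.sub_mem_line hmem hE hconst hγ hγ0 h0 h1
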